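/- Let $(X,\mathcal A,\mu)$ be a $\sigma$-finite Lebesgue space with $\mu$ continuous (atomless) and $\mu(X)=\infty$, and let $G$ be a countable group acting on it by measure preserving automorphisms $T^g$, $g\in G$. Let $X^*$ be the set of countable sums of Dirac masses on $X$; for $A\in\mathcal A$ let $N_A(\nu)=\nu(A)$, and let $\mathcal A^*$ be the $\sigma$-algebra on $X^*$ generated by the maps $N_A$, $A\in\mathcal A$. Let $\mu^*$ be the Poisson measure over $\mu$, that is, the unique probability measure on $(X^*,\mathcal A^*)$ such that for pairwise disjoint $A_1,\dots,A_k\in\mathcal A$ of finite measure the variables $N_{A_1},\dots,N_{A_k}$ are independent and Poisson distributed with parameters $\mu(A_1),\dots,\mu(A_k)$. The group $G$ acts on $(X^*,\mathcal A^*,\mu^*)$ by $T^g_*\nu=\nu\circ (T^g)^{-1}$; this system is the Poisson suspension. A factor of a measure preserving system is an invariant sub-$\sigma$-algebra on which the measure is $\sigma$-finite; sub-$\sigma$-algebras of $\mathcal A^*$ are identified when they coincide up to $\mu^*$-null sets. Let $\mathcal F\subset\mathcal A^*$ be a factor of the Poisson suspension that is non-trivial, i.e. contains a set of $\mu^*$-measure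 different from $0$ and $1$. Let $\mu^*\otimes_{\mathcal F}\mu^*$ be the relatively independent self-joining over $\mathcal F$, i.e. the probability measure on $(X^*\times X^*,\mathcal A^*\otimes\mathcal A^*)$ determined by $$(\mu^*\otimes_{\mathcal F}\mu^*)(A\times B)=\int_{X^*}\mathbb E[1_A\mid\mathcal F]\,\mathbb E[1_B\mid\mathcal F]\,d\mu^*\qquad (A,B\in\mathcal A^*).$$ Suppose that this joining is Poissonian, i.e. infinitely divisible: for every integer $k\ge 1$ it is the $k$-fold convolution power of some probability measure on $X^*\times X^*$, where addition on $X^*\times X^*$ is the coordinatewise sum of measures. Then $\mathcal F$ is a Poissonian factor: there exist a $G$-invariant set $K\in\mathcal A$ with $\mu(K)>0$ and a factor $\mathcal B_{|K}$ of the restricted system $(K,\mathcal A_{|K},\mu_{|K},T^g)$ such that $\mathcal F=(\mathcal B_{|K})^*:=\sigma\{N_A : A\in\mathcal B_{|K}\}$ up to $\mu^*$-null sets. -/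

import Mathlib

open MeasureTheory ProbabilityTheory
open scoped ENNReal NNReal

noncomputable section

namespace PoissonSuspension

/-- The measures of the form `∑ i, δ_{x i}` (countably many terms, possibly none), as an additive
submonoid of the measures on `X`. -/
def configSubmonoid (X : Type*) [MeasurableSpace X] : AddSubmonoid (Measure X) where
  carrier := {ν | ∃ (ι : Type) (_ : Countable ι) (x : ι → X),
    ν = Measure.sum fun i => Measure.dirac (x i)}
  zero_mem' := ⟨Empty, inferInstance, Empty.elim, by simp⟩
  add_mem' := by
    rintro _ _ ⟨ι, hι, x, rfl⟩ ⟨κ, hκ, y, rfl⟩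
    refine ⟨ι ⊕ κ, inferInstance, Sum.elim x y, ?_⟩
    ext s hs
    rw [Measure.add_apply, Measure.sum_apply _ hs, Measure.sum_apply _ hs, Measure.sum_apply _ hs,
      Summable.tsum_sum (f := fun i => Measure.dirac (Sum.elim x y i) s)
        ENNReal.summable ENNReal.summable]
    simp

/-- The configuration space `X*` of all countable sums of Dirac masses on `X`. -/
def Config (X : Type*) [MeasurableSpace X] : Type _ := configSubmonoid X

namespace Config

variable {X : Type*} [MeasurableSpace X]

/-- Addition on `X*` is the sum of measures. -/
instance : AddCommMonoid (Config X) := inferInstanceAs (AddCommMonoid (configSubmonoid X))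

/-- `count A ν = N_A(ν) = ν(A)`. -/
def count (A : Set X) (ν : Config X) : ℝ≥0∞ := ν.1 A

/-- The `σ`-algebra `A*` on `X*`, generated by the maps `N_A`, `A` measurable. -/
instance : MeasurableSpace (Config X) :=
  ⨆ A : {A : Set X // MeasurableSet A}, MeasurableSpace.comap (count A.1) inferInstance

theorem measurable_count {A : Set X} (hA : MeasurableSet A) :
    Measurable (count A : Config X → ℝ≥0∞) :=
  Measurable.of_comap_le
    (le_iSup (fun A : {A : Set X // MeasurableSet A} =>
      MeasurableSpace.comap (count A.1 : Config X → ℝ≥0∞) inferInstance) ⟨A, hA⟩)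

theorem measurable_of_count {Ω : Type*} [MeasurableSpace Ω] {f : Ω → Config X}
    (hf : ∀ A, MeasurableSet A → Measurable fun ω => count A (f ω)) : Measurable f := by
  rw [measurable_iff_comap_le, instMeasurableSpace, MeasurableSpace.comap_iSup]
  refine iSup_le fun A => ?_
  rw [MeasurableSpace.comap_comp]
  exact (hf A.1 A.2).comap_le

instance : MeasurableAdd₂ (Config X) where
  measurable_add := measurable_of_count fun _ hA =>
    ((measurable_count hA).comp measurable_fst).add ((measurable_count hA).comp measurable_snd)

variable {G : Type*} [Group G] [MulAction G X] [MeasurableConstSMul G X]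

/-- The action `T_*` on `X*` induced by the action on `X`: `(g • ν)(A) = ν(g⁻¹ A)`, i.e. the image
of `ν` under `x ↦ g • x`. -/
instance : MulAction G (Config X) where
  smul g ν := ⟨ν.1.map (g • ·), by
    obtain ⟨ι, hι, x, h⟩ := ν.2
    refine ⟨ι, hι, fun i => g • x i, ?_⟩
    have hg : Measurable fun y : X => g • y := measurable_const_smul g
    rw [h, Measure.map_sum hg.aemeasurable]
    congr 1
    funext i
    rw [Measure.map_dirac' hg]⟩
  one_smul ν := Subtype.ext (by
    change ν.1.map ((1 : G) • ·) = ν.1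
    simp)
  mul_smul g h ν := Subtype.ext (by
    change ν.1.map ((g * h) • ·) = (ν.1.map (h • ·)).map (g • ·)
    rw [Measure.map_map (measurable_const_smul g) (measurable_const_smul h)]
    congr 1
    funext x
    exact mul_smul g h x)

theorem count_smul (g : G) (ν : Config X) {A : Set X} (hA : MeasurableSet A) :
    count A (g • ν) = count ((g • ·) ⁻¹' A) ν :=
  Measure.map_apply (measurable_const_smul g) hA

end Config

/-- `P` is the Poisson measure `μ*` over `(X, μ)`: for pairwise disjoint measurable sets
`A 0, …, A (k-1)` of finite `μ`-measure, the variables `N_{A i}` are independent and Poisson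
distributed with parameters `μ (A i)`. -/
structure IsPoissonMeasure {X : Type*} [MeasurableSpace X] (μ : Measure X)
    (P : Measure (Config X)) : Prop where
  isProbabilityMeasure : IsProbabilityMeasure P
  law : ∀ (k : ℕ) (A : Fin k → Set X), (∀ i, MeasurableSet (A i)) → (∀ i, μ (A i) < ∞) →
    Pairwise (Function.onFun Disjoint A) →
    iIndepFun (fun i => Config.count (A i)) P ∧
    ∀ i, P.map (Config.count (A i)) =
      (poissonMeasure (μ (A i)).toNNReal).map (fun n : ℕ => (n : ℝ≥0∞))

/-- A factor of the system `(Y, μ, G)`: a `G`-invariant sub-`σ`-algebra on which `μ` is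
`σ`-finite. -/
structure IsFactor (G : Type*) {Y : Type*} [Group G] [MulAction G Y] {mY : MeasurableSpace Y}
    (μ : Measure Y) (B : MeasurableSpace Y) : Prop where
  le : B ≤ mY
  invariant : ∀ (g : G) (s : Set Y), MeasurableSet[B] s → MeasurableSet[B] ((g • ·) ⁻¹' s)
  sigmaFinite : SigmaFinite (μ.trim le)

/-- The restriction of `μ` to a subset `K`, as a measure on `K`. -/
def restrictMeasure {X : Type*} [MeasurableSpace X] (μ : Measure X) (K : Set X) : Measure K :=
  μ.comap Subtype.val

/-- The `σ`-algebra `σ{N_A : A ∈ B}` on `X*`, for a `σ`-algebra `B` on a subset `K` of `X`. -/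
@[reducible]
def poissonAlgebra {X : Type*} [MeasurableSpace X] {K : Set X} (B : MeasurableSpace K) :
    MeasurableSpace (Config X) :=
  ⨆ A : {A : Set K // MeasurableSet[B] A},
    MeasurableSpace.comap (Config.count (Subtype.val '' A.1)) inferInstance

/-- The completion of a `σ`-algebra `F` by the `P`-null sets: the sets that coincide with an
element of `F` up to a `P`-null set. -/
@[reducible]
def nullCompletion {Ω : Type*} {m0 : MeasurableSpace Ω} (P : Measure Ω) (F : MeasurableSpace Ω) :
    MeasurableSpace Ω :=
  eventuallyMeasurableSpace F (ae P)

/-- `J` is the relatively independent self-joining of `(Ω, P)` over the sub-`σ`-algebra `F`: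
`J(A × B) = ∫ E[1_A | F] E[1_B | F] dP`. -/
def IsRelIndepSelfJoining {Ω : Type*} (F : MeasurableSpace Ω) {m0 : MeasurableSpace Ω}
    (P : Measure Ω) (J : Measure (Ω × Ω)) : Prop :=
  ∀ A B : Set Ω, MeasurableSet[m0] A → MeasurableSet[m0] B →
    J (A ×ˢ B) = ENNReal.ofReal
      (∫ ω, (P[A.indicator (fun _ => (1 : ℝ)) | F]) ω *
        (P[B.indicator (fun _ => (1 : ℝ)) | F]) ω ∂P)

/-- `p` is infinitely divisible: for every `k ≥ 1` it is the `k`-fold convolution power of a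
probability measure `q`, i.e. the law of the sum of `k` independent variables of law `q`. -/
def IsInfinitelyDivisible {M : Type*} [AddCommMonoid M] {m0 : MeasurableSpace M}
    (p : Measure M) : Prop :=
  ∀ k : ℕ, 1 ≤ k → ∃ q : Measure M, IsProbabilityMeasure q ∧
    p = (Measure.pi fun _ : Fin k => q).map (fun x => ∑ i, x i)

end PoissonSuspension

end

/-! The proof tests everything on the void events `void A = {N_A = 0}`. They form a π-system on
which a Poisson measure takes the value `exp (-μ A)`, and since `μ` has no atoms they generate the
σ-algebra of `X*` up to null sets (`exists_voidAlgebra_ae_eq`). Hence an integrable function is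
determined by its integrals over void events.

Write `J (void A × void B) = exp (-μ A - μ B + m A B)`. A sum of configurations avoids a set exactly
when every summand does, so a `k`-th convolution root `q k` of `J` turns void probabilities into
`k`-th roots. Thus `m A B` is the limit of `k` times the `q k`-probability of meeting `A` in the
first coordinate and `B` in the second. This makes `m` nonnegative, symmetric, additive and
dominated by `μ` (`isPairing_voidPairing`), so `m A B = ∫_B φ A dμ` for a symmetric sub-Markov
operator `Φ : 1_A ↦ φ A`.

Comparing integrals over void events, `E[1_{void A} | F]` is a constant times the product of `1 - φ
A x` over the points `x` of the configuration (`IsVoidKernel.condExp_void`). Idempotence of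
conditional expectation then becomes `Φ² = Φ`: each `φ A` is fixed by `Φ` (`IsVoidKernel.isFixed`).
Fixed functions of a sub-Markov operator are stable under truncation, so the positive superlevel
sets of the nonnegative ones are fixed sets, and fixed sets are closed under differences, finite
unions and countable unions of finite measure. A set `A` is fixed iff `void A` lies in the
completion of `F`, which transfers the invariance of `F` to fixed sets.

Take for `K` an invariant countable union of fixed sets that contains all fixed sets mod `μ`, and
for `B` the sets whose traces on these are fixed. Counts of fixed sets are `F`-measurable, so `σ{N_A
: A ∈ B}` lies in the completion of `F`. Conversely each `φ A` lives on `K` and is `B`-measurable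
there, so every `E[1_{void A} | F]` is measurable for `σ{N_A : A ∈ B}`; by self-adjointness of
conditional expectation this gives the other inclusion (`le_nullCompletion_of_condExp_void`). -/

namespace PoissonSuspension

open Filter Topology

/-! ### Exponential and logarithm on `[0, ∞]`; Poisson laws. -/

/-- The function `x ↦ exp (-x)` on `[0, ∞]`. -/
noncomputable def expNeg (x : ℝ≥0∞) : ℝ≥0∞ := EReal.exp (-(x : EReal))

/-- The function `x ↦ -log x` from `[0, 1]` to `[0, ∞]`, the inverse of `expNeg`. -/
noncomputable def negLog (x : ℝ≥0∞) : ℝ≥0∞ := (-(ENNReal.log x)).toENNReal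

theorem expNeg_zero : expNeg 0 = 1 := by simp [expNeg]

theorem expNeg_top : expNeg ∞ = 0 := by simp [expNeg]

theorem expNeg_add (x y : ℝ≥0∞) : expNeg (x + y) = expNeg x * expNeg y := by
  rw [expNeg, expNeg, expNeg, ← EReal.exp_add, EReal.coe_ennreal_add,
    EReal.neg_add (Or.inl (by simp)) (Or.inr (by simp)), sub_eq_add_neg]

theorem expNeg_le_one (x : ℝ≥0∞) : expNeg x ≤ 1 := by
  rw [expNeg, EReal.exp_le_one_iff]
  simpa using EReal.coe_ennreal_nonneg x

theorem expNeg_antitone : Antitone expNeg := fun x y h => by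
  rw [expNeg, expNeg, EReal.exp_le_exp_iff, EReal.neg_le_neg_iff]
  exact_mod_cast h

theorem continuous_expNeg : Continuous expNeg :=
  ENNReal.continuous_exp.comp (continuous_neg.comp continuous_coe_ennreal_ereal)

theorem measurable_expNeg : Measurable expNeg := continuous_expNeg.measurable

theorem measurable_negLog : Measurable negLog := by
  unfold negLog
  fun_prop

theorem expNeg_of_ne_top {x : ℝ≥0∞} (hx : x ≠ ∞) :
    expNeg x = ENNReal.ofReal (Real.exp (-x.toReal)) := by
  lift x to ℝ≥0 using hx
  rw [expNeg, ← EReal.exp_coe]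
  rfl

theorem expNeg_toReal {x : ℝ≥0∞} (hx : x ≠ ∞) : (expNeg x).toReal = Real.exp (-x.toReal) := by
  rw [expNeg_of_ne_top hx, ENNReal.toReal_ofReal (Real.exp_pos _).le]

theorem expNeg_nat_mul (x : ℝ≥0∞) (n : ℕ) : expNeg (x * n) = expNeg x ^ n := by
  induction n with
  | zero => simp [expNeg_zero]
  | succ n ih => rw [Nat.cast_succ, mul_add, mul_one, expNeg_add, ih, pow_succ]

theorem expNeg_negLog {x : ℝ≥0∞} (hx : x ≤ 1) : expNeg (negLog x) = x := by
  have : 0 ≤ -(ENNReal.log x) := by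
    rw [EReal.le_neg, neg_zero]
    simpa using ENNReal.log_monotone hx
  rw [expNeg, negLog, EReal.coe_toENNReal this, neg_neg, ENNReal.exp_log]

theorem negLog_expNeg (x : ℝ≥0∞) : negLog (expNeg x) = x := by
  rw [expNeg, negLog, EReal.log_exp, neg_neg, EReal.toENNReal_coe]

theorem expNeg_sum {ι : Type*} (s : Finset ι) (x : ι → ℝ≥0∞) :
    expNeg (∑ i ∈ s, x i) = ∏ i ∈ s, expNeg (x i) := by
  classical
  induction s using Finset.induction_on with
  | empty => simp [expNeg_zero]
  | insert i s hi ih => rw [Finset.sum_insert hi, Finset.prod_insert hi, expNeg_add, ih]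

theorem expNeg_top_mul (x : ℝ≥0∞) : expNeg (∞ * x) = if x = 0 then 1 else 0 := by
  split_ifs with h
  · simp [h, expNeg_zero]
  · rw [ENNReal.top_mul h, expNeg_top]

/-- The generating function of the Poisson law at `z = exp (-c)`, summed by the exponential series.
The value `c = ∞`, `z = 0` is included and later yields the void probabilities. -/
theorem lintegral_expNeg_poissonMeasure (c : ℝ≥0∞) (r : ℝ≥0) :
    ∫⁻ n : ℕ, expNeg (c * n) ∂(poissonMeasure r) = expNeg ((1 - expNeg c) * r) := by
  obtain ⟨z, hz⟩ : ∃ z : ℝ≥0, expNeg c = z :=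
    ⟨(expNeg c).toNNReal, (ENNReal.coe_toNNReal
      ((expNeg_le_one c).trans_lt ENNReal.one_lt_top).ne).symm⟩
  have hz1 : z ≤ 1 := by exact_mod_cast hz ▸ expNeg_le_one c
  have hterm : ∀ n : ℕ, expNeg (c * n) * poissonMeasure r {n} =
      ENNReal.ofReal (Real.exp (-r) * ((z * r : ℝ) ^ n / n.factorial)) := by
    intro n
    rw [expNeg_nat_mul, poissonMeasure_singleton, hz, ← ENNReal.ofReal_coe_nnreal,
      ← ENNReal.ofReal_pow (by positivity), ← ENNReal.ofReal_mul (by positivity)]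
    congr 1
    rw [mul_pow]
    ring
  have hsum : HasSum (fun n : ℕ => Real.exp (-r) * ((z * r : ℝ) ^ n / n.factorial))
      (Real.exp (-r) * Real.exp (z * r)) := by
    rw [Real.exp_eq_exp_ℝ]
    exact (NormedSpace.expSeries_div_hasSum_exp (z * r : ℝ)).mul_left _
  rw [lintegral_countable']
  simp_rw [hterm]
  rw [← ENNReal.ofReal_tsum_of_nonneg (fun n => by positivity) hsum.summable, hsum.tsum_eq,
    ← Real.exp_add, hz, expNeg_of_ne_top (by finiteness), ENNReal.toReal_mul,
    ENNReal.toReal_sub_of_le (by exact_mod_cast hz1) (by simp)]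
  congr 2
  simp
  ring

theorem lintegral_id_poissonMeasure (r : ℝ≥0) :
    ∫⁻ n : ℕ, (n : ℝ≥0∞) ∂(poissonMeasure r) = r := by
  rw [lintegral_countable', tsum_eq_zero_add' ENNReal.summable]
  have hterm : ∀ n : ℕ, ((n + 1 : ℕ) : ℝ≥0∞) * poissonMeasure r {n + 1} =
      r * poissonMeasure r {n} := by
    intro n
    rw [poissonMeasure_singleton, poissonMeasure_singleton, ← ENNReal.ofReal_natCast,
      ← ENNReal.ofReal_coe_nnreal, ← ENNReal.ofReal_mul (by positivity),
      ← ENNReal.ofReal_mul (by positivity)]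
    congr 1
    rw [Nat.factorial_succ]
    push_cast
    field_simp
    ring
  have h1 : ∑' n : ℕ, poissonMeasure r {n} = 1 := by
    have := lintegral_countable' (μ := poissonMeasure r) (fun _ : ℕ => (1 : ℝ≥0∞))
    simpa using this.symm
  simp_rw [hterm]
  rw [ENNReal.tsum_mul_left, h1]
  simp

/-! ### The Laplace functional of a Poisson measure. -/

section Laplace

variable {X : Type*} [MeasurableSpace X]

theorem Config.measurable_coe : Measurable (fun ν : Config X => (ν.1 : Measure X)) :=
  Measure.measurable_of_measurable_coe _ fun _ hs => Config.measurable_count hs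

theorem Config.measurable_lintegral {f : X → ℝ≥0∞} (hf : Measurable f) :
    Measurable fun ν : Config X => ∫⁻ x, f x ∂ν.1 :=
  (Measure.measurable_lintegral hf).comp Config.measurable_coe

variable {μ : Measure X} {P : Measure (Config X)}

theorem IsPoissonMeasure.map_count (hP : IsPoissonMeasure μ P) {A : Set X} (hA : MeasurableSet A)
    (hμA : μ A < ∞) : P.map (Config.count A) =
      (poissonMeasure (μ A).toNNReal).map (fun n : ℕ => (n : ℝ≥0∞)) :=
  (hP.law 1 (fun _ => A) (fun _ => hA) (fun _ => hμA)
    (fun i j hij => (hij (Subsingleton.elim i j)).elim)).2 0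

theorem IsPoissonMeasure.lintegral_comp_count (hP : IsPoissonMeasure μ P) {A : Set X}
    (hA : MeasurableSet A) (hμA : μ A < ∞) {g : ℝ≥0∞ → ℝ≥0∞} (hg : Measurable g) :
    ∫⁻ ν, g (Config.count A ν) ∂P = ∫⁻ n : ℕ, g n ∂(poissonMeasure (μ A).toNNReal) := by
  rw [← lintegral_map hg (Config.measurable_count hA), hP.map_count hA hμA,
    lintegral_map hg (by fun_prop)]

theorem IsPoissonMeasure.lintegral_count (hP : IsPoissonMeasure μ P) {A : Set X}
    (hA : MeasurableSet A) (hμA : μ A < ∞) : ∫⁻ ν, Config.count A ν ∂P = μ A := by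
  refine (hP.lintegral_comp_count hA hμA measurable_id).trans ?_
  simp only [id]
  rw [lintegral_id_poissonMeasure, ENNReal.coe_toNNReal hμA.ne]

theorem IsPoissonMeasure.lintegral_expNeg_sum (hP : IsPoissonMeasure μ P) {k : ℕ}
    (A : Fin k → Set X) (hA : ∀ i, MeasurableSet (A i)) (hμA : ∀ i, μ (A i) < ∞)
    (hd : Pairwise (Function.onFun Disjoint A)) (c : Fin k → ℝ≥0∞) :
    ∫⁻ ν, expNeg (∑ i, c i * Config.count (A i) ν) ∂P =
      expNeg (∑ i, (1 - expNeg (c i)) * μ (A i)) := by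
  have hm : ∀ i, Measurable fun x : ℝ≥0∞ => expNeg (c i * x) := fun i =>
    measurable_expNeg.comp (measurable_const.mul measurable_id)
  have hind := (hP.law k A hA hμA hd).1.comp (fun i x => expNeg (c i * x)) hm
  simp_rw [expNeg_sum]
  rw [lintegral_prod_eq_prod_lintegral_of_indepFun Finset.univ
    (fun i ν => expNeg (c i * Config.count (A i) ν)) hind
    (fun i => (hm i).comp (Config.measurable_count (hA i)))]
  refine Finset.prod_congr rfl fun i _ => ?_
  rw [hP.lintegral_comp_count (hA i) (hμA i) (hm i), lintegral_expNeg_poissonMeasure,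
    ENNReal.coe_toNNReal (hμA i).ne]

theorem IsPoissonMeasure.lintegral_expNeg_simpleFunc (hP : IsPoissonMeasure μ P)
    (f : SimpleFunc X ℝ≥0∞) (hf : ∀ c ≠ 0, μ (f ⁻¹' {c}) < ∞) :
    ∫⁻ ν, expNeg (∫⁻ x, f x ∂ν.1) ∂P = expNeg (∫⁻ x, (1 - expNeg (f x)) ∂μ) := by
  classical
  -- The value `0` is left out: its fibre may have infinite measure, and it contributes nothing to
  -- either integral.
  set s := f.range.filter (· ≠ 0) with hs
  let e := s.equivFin.symm
  have key : ∀ (m : Measure X) (h : ℝ≥0∞ → ℝ≥0∞), h 0 = 0 →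
      ∫⁻ x, h (f x) ∂m = ∑ i, h (e i).1 * m (f ⁻¹' {(e i).1}) := by
    intro m h h0
    have : ∫⁻ x, h (f x) ∂m = ∫⁻ x, (f.map h) x ∂m := rfl
    rw [this, SimpleFunc.lintegral_eq_lintegral, SimpleFunc.map_lintegral,
      Equiv.sum_comp e (fun c : s => h c.1 * m (f ⁻¹' {c.1})),
      Finset.sum_coe_sort s (fun c => h c * m (f ⁻¹' {c})), hs, Finset.sum_filter]
    refine Finset.sum_congr rfl fun c _ => ?_
    by_cases hc : c = 0 <;> simp [hc, h0]
  have hne : ∀ i, (e i).1 ≠ 0 := fun i => (Finset.mem_filter.mp (e i).2).2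
  have h1 : ∀ ν : Config X, ∫⁻ x, f x ∂ν.1 =
      ∑ i, (e i).1 * Config.count (f ⁻¹' {(e i).1}) ν := fun ν => key ν.1 id rfl
  simp_rw [h1]
  rw [hP.lintegral_expNeg_sum (fun i => f ⁻¹' {(e i).1}) (fun i => f.measurableSet_preimage _)
    (fun i => hf _ (hne i)), key μ (fun c => 1 - expNeg c) (by simp [expNeg_zero])]
  intro i j hij
  refine Disjoint.preimage _ (Set.disjoint_singleton.mpr fun h => hij ?_)
  exact e.injective (Subtype.ext h)

/-- The Laplace functional of a Poisson measure. -/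
theorem IsPoissonMeasure.lintegral_expNeg [SigmaFinite μ] (hP : IsPoissonMeasure μ P)
    {f : X → ℝ≥0∞} (hf : Measurable f) :
    ∫⁻ ν, expNeg (∫⁻ x, f x ∂ν.1) ∂P = expNeg (∫⁻ x, (1 - expNeg (f x)) ∂μ) := by
  have := hP.isProbabilityMeasure
  -- Cutting off outside the spanning sets gives the nonzero fibres finite measure. The left side
  -- then converges by domination by `1`, the right side monotonically.
  let F : ℕ → SimpleFunc X ℝ≥0∞ := fun n =>
    (SimpleFunc.eapprox f n).restrict (spanningSets μ n)
  have hFind : ∀ n x, F n x = (spanningSets μ n).indicator (SimpleFunc.eapprox f n) x :=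
    fun n x => by
      rw [SimpleFunc.restrict_apply _ (measurableSet_spanningSets μ n)]
  have hmono : ∀ x, Monotone fun n => F n x := by
    intro x n n' hn
    simp only [hFind]
    refine (Set.indicator_le_indicator_of_subset (monotone_spanningSets μ hn)
      (fun _ => zero_le) x).trans ?_
    exact Set.indicator_le_indicator (SimpleFunc.monotone_eapprox f hn x)
  have hlim : ∀ x, Tendsto (fun n => F n x) atTop (𝓝 (f x)) := by
    intro x
    refine (SimpleFunc.tendsto_eapprox hf x).congr' ?_
    filter_upwards [eventually_ge_atTop (spanningSetsIndex μ x)] with n hn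
    rw [hFind, Set.indicator_of_mem]
    exact monotone_spanningSets μ hn (mem_spanningSetsIndex μ x)
  have hfin : ∀ n, ∀ c ≠ 0, μ (F n ⁻¹' {c}) < ∞ := by
    intro n c hc
    refine (measure_mono ?_).trans_lt (measure_spanningSets_lt_top μ n)
    intro x hx
    by_contra hxn
    rw [Set.mem_preimage, hFind, Set.indicator_of_notMem hxn] at hx
    exact hc hx.symm
  have hL : Tendsto (fun n => ∫⁻ ν, expNeg (∫⁻ x, F n x ∂ν.1) ∂P) atTop
      (𝓝 (∫⁻ ν, expNeg (∫⁻ x, f x ∂ν.1) ∂P)) := by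
    refine tendsto_lintegral_of_dominated_convergence (fun _ => 1)
      (fun n => measurable_expNeg.comp (Config.measurable_lintegral (F n).measurable))
      (fun n => Eventually.of_forall fun ν => expNeg_le_one _) (by simp)
      (Eventually.of_forall fun ν => ?_)
    exact (continuous_expNeg.tendsto _).comp (lintegral_tendsto_of_tendsto_of_monotone
      (fun n => (F n).measurable.aemeasurable) (Eventually.of_forall hmono)
      (Eventually.of_forall hlim))
  have hR : Tendsto (fun n => expNeg (∫⁻ x, (1 - expNeg (F n x)) ∂μ)) atTop
      (𝓝 (expNeg (∫⁻ x, (1 - expNeg (f x)) ∂μ))) := by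
    refine (continuous_expNeg.tendsto _).comp (lintegral_tendsto_of_tendsto_of_monotone
      (fun n => (measurable_const.sub (measurable_expNeg.comp (F n).measurable)).aemeasurable)
      (Eventually.of_forall fun x n n' hn => tsub_le_tsub_left (expNeg_antitone (hmono x hn)) _)
      (Eventually.of_forall fun x => ?_))
    exact ((ENNReal.continuous_sub_left ENNReal.one_ne_top).comp
      continuous_expNeg).tendsto _ |>.comp (hlim x)
  refine tendsto_nhds_unique hL (hR.congr fun n => ?_)
  rw [hP.lintegral_expNeg_simpleFunc _ (hfin n)]

end Laplace

theorem measurable_tsum_ennreal {α : Type*} {m : MeasurableSpace α} {f : ℕ → α → ℝ≥0∞}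
    (hf : ∀ n, Measurable (f n)) : Measurable fun x => ∑' n, f n x :=
  Measurable.tsum hf

/-! ### Void events determine a Poisson measure. -/

section Void

variable {X : Type*} [MeasurableSpace X]

/-- The event that a configuration has no point in `A`. -/
def void (A : Set X) : Set (Config X) := {ν | Config.count A ν = 0}

theorem measurableSet_void {A : Set X} (hA : MeasurableSet A) : MeasurableSet (void A) :=
  Config.measurable_count hA (measurableSet_singleton 0)

theorem void_empty : void (∅ : Set X) = Set.univ :=
  Set.eq_univ_of_forall fun ν => measure_empty (μ := ν.1)

theorem void_inter_void (A B : Set X) : void A ∩ void B = void (A ∪ B) := by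
  ext ν
  exact (measure_union_null_iff (μ := ν.1)).symm

theorem Config.one_le_count {A : Set X} (hA : MeasurableSet A) {ν : Config X}
    (h : Config.count A ν ≠ 0) : 1 ≤ Config.count A ν := by
  obtain ⟨ν, ι, _, x, rfl⟩ := ν
  change Measure.sum (fun i => Measure.dirac (x i)) A ≠ 0 at h
  change 1 ≤ Measure.sum (fun i => Measure.dirac (x i)) A
  rw [Measure.sum_apply _ hA] at h ⊢
  obtain ⟨i, hi⟩ : ∃ i, Measure.dirac (x i) A ≠ 0 := by
    by_contra! hne
    exact h (by simp [hne])
  refine le_trans ?_ (ENNReal.le_tsum i)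
  rw [Measure.dirac_apply' _ hA] at hi ⊢
  by_cases hx : x i ∈ A <;> simp_all

variable {μ : Measure X} {P : Measure (Config X)}

theorem expNeg_lintegral_indicator_top {A : Set X} (hA : MeasurableSet A) (ν : Config X) :
    expNeg (∫⁻ x, A.indicator (fun _ => ∞) x ∂ν.1) = (void A).indicator 1 ν := by
  classical
  rw [lintegral_indicator_const hA, expNeg_top_mul, Set.indicator_apply]
  exact if_congr Iff.rfl rfl rfl

/-- The Laplace functional at `f = ∞ · 1_A`, where `exp (-∞ · N_A)` is the indicator of `N_A = 0`.
-/
theorem IsPoissonMeasure.measure_void [SigmaFinite μ] (hP : IsPoissonMeasure μ P) {A : Set X}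
    (hA : MeasurableSet A) : P (void A) = expNeg (μ A) := by
  have h := hP.lintegral_expNeg (f := A.indicator fun _ => ∞) (measurable_const.indicator hA)
  simp_rw [expNeg_lintegral_indicator_top hA] at h
  rw [lintegral_indicator_one (measurableSet_void hA)] at h
  rw [h, ← lintegral_indicator_one hA]
  congr 1
  refine lintegral_congr fun x => ?_
  by_cases hx : x ∈ A <;> simp [hx, expNeg_zero, expNeg_top]

theorem IsPoissonMeasure.measureReal_void [SigmaFinite μ] (hP : IsPoissonMeasure μ P) {A : Set X}
    (hA : MeasurableSet A) (hμA : μ A < ∞) : P.real (void A) = Real.exp (-μ.real A) := by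
  rw [measureReal_def, hP.measure_void hA, expNeg_toReal hμA.ne, measureReal_def]

variable (μ) in
/-- The `σ`-algebra generated by the void events of the sets of finite measure. -/
@[reducible]
def voidAlgebra : MeasurableSpace (Config X) :=
  MeasurableSpace.generateFrom {s | ∃ A, MeasurableSet A ∧ μ A < ∞ ∧ s = void A}

theorem voidAlgebra_le : voidAlgebra μ ≤ (inferInstance : MeasurableSpace (Config X)) := by
  refine MeasurableSpace.generateFrom_le ?_
  rintro _ ⟨B, hB, -, rfl⟩
  exact measurableSet_void hB

/-- Points are null, so outer regularity gives each of them an open neighbourhood that meets `A` in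
small measure; countably many of these cover `X` and can be made disjoint. -/
theorem exists_partition_measure_le [StandardBorelSpace X] [NullSingletonClass μ] {A : Set X}
    (hμA : μ A < ∞) {ε : ℝ≥0∞} (hε : 0 < ε) :
    ∃ C : ℕ → Set X, (∀ n, MeasurableSet (C n)) ∧ Pairwise (Function.onFun Disjoint C) ∧
      ⋃ n, C n = Set.univ ∧ ∀ n, μ (A ∩ C n) ≤ ε := by
  let := upgradeStandardBorel X
  have : IsFiniteMeasure (μ.restrict A) := ⟨by simpa using hμA⟩
  have hU : ∀ x : X, ∃ U : Set X, {x} ⊆ U ∧ IsOpen U ∧ (μ.restrict A) U < ε := fun x =>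
    Set.exists_isOpen_lt_of_lt {x} ε (by simpa using hε)
  choose U hxU hUo hUε using hU
  obtain ⟨s, hs, hsU⟩ := TopologicalSpace.countable_cover_nhds
    (fun x => (hUo x).mem_nhds (hxU x rfl))
  obtain ⟨D, hDm, hDU, hDε⟩ : ∃ D : ℕ → Set X, (∀ n, MeasurableSet (D n)) ∧
      ⋃ n, D n = Set.univ ∧ ∀ n, (μ.restrict A) (D n) ≤ ε := by
    rcases s.eq_empty_or_nonempty with rfl | hne
    · exact ⟨fun _ => ∅, by simp, by simpa using hsU, by simp⟩
    · obtain ⟨x, rfl⟩ := hs.exists_eq_range hne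
      exact ⟨fun n => U (x n), fun n => (hUo _).measurableSet, by simpa using hsU,
        fun n => (hUε _).le⟩
  refine ⟨disjointed D, MeasurableSet.disjointed hDm, disjoint_disjointed D,
    by rw [iUnion_disjointed, hDU], fun n => ?_⟩
  rw [Set.inter_comm, ← Measure.restrict_apply (MeasurableSet.disjointed hDm n)]
  exact (measure_mono (disjointed_subset D n)).trans (hDε n)

/-- A rearrangement of `(1 + x) exp (-x) ≤ 1`. With `x` the measure of a small cell, the probability
that the cell is occupied is almost its measure. -/
theorem le_one_add_mul_one_sub_expNeg {x ε : ℝ≥0∞} (hε : ε ≠ ∞) (hx : x ≤ ε) :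
    x ≤ (1 + ε) * (1 - expNeg x) := by
  have hx' : x ≠ ∞ := (hx.trans_lt hε.lt_top).ne
  have h1 : expNeg x ≠ ∞ := ((expNeg_le_one x).trans_lt ENNReal.one_lt_top).ne
  rw [← ENNReal.toReal_le_toReal hx' (by finiteness), ENNReal.toReal_mul,
    ENNReal.toReal_sub_of_le (expNeg_le_one x) (by simp), expNeg_toReal hx',
    ENNReal.toReal_add (by simp) hε, ENNReal.toReal_one]
  have h2 : x.toReal ≤ ε.toReal := ENNReal.toReal_mono hε hx
  have h3 : 0 ≤ x.toReal := ENNReal.toReal_nonneg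
  have h4 : Real.exp (-x.toReal) ≤ 1 := Real.exp_le_one_iff.mpr (by linarith)
  have h5 : (1 + x.toReal) * Real.exp (-x.toReal) ≤ 1 := by
    have := Real.add_one_le_exp x.toReal
    calc (1 + x.toReal) * Real.exp (-x.toReal) ≤ Real.exp x.toReal * Real.exp (-x.toReal) := by
          gcongr; linarith
      _ = 1 := by rw [← Real.exp_add]; simp
  nlinarith

/-- The number `Z j` of occupied cells in a partition of `A` of mesh `1 / (j + 1)` is at most `N_A`,
and its mean tends to `μ A`, the mean of `N_A`. Hence `⨆ j, Z j` equals `N_A` almost surely. It is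
built from `μ` alone, the same for every `P`. -/
theorem exists_count_ae_eq_of_lt_top [StandardBorelSpace X] [SigmaFinite μ]
    [NullSingletonClass μ] {A : Set X} (hA : MeasurableSet A) (hμA : μ A < ∞) :
    ∃ Z : Config X → ℝ≥0∞, Measurable[voidAlgebra μ] Z ∧
      ∀ P : Measure (Config X), IsPoissonMeasure μ P → Config.count A =ᵐ[P] Z := by
  have hε : ∀ j : ℕ, (0 : ℝ≥0∞) < ((j : ℝ≥0∞) + 1)⁻¹ := fun j => ENNReal.inv_pos.mpr (by finiteness)
  choose C hCm hCd hCU hCε using fun j : ℕ => exists_partition_measure_le hμA (hε j)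
  have hACm : ∀ j n, MeasurableSet (A ∩ C j n) := fun j n => hA.inter (hCm j n)
  let Z : ℕ → Config X → ℝ≥0∞ := fun j ν => ∑' n, (void (A ∩ C j n))ᶜ.indicator 1 ν
  have hZm : ∀ j, Measurable[voidAlgebra μ] (Z j) := by
    intro j
    refine measurable_tsum_ennreal fun n => ?_
    refine Measurable.indicator (m := voidAlgebra μ) (f := 1)
      (@measurable_const _ _ _ (voidAlgebra μ) 1) (MeasurableSet.compl ?_)
    exact MeasurableSpace.measurableSet_generateFrom
      ⟨_, hACm j n, (measure_mono Set.inter_subset_left).trans_lt hμA, rfl⟩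
  refine ⟨fun ν => ⨆ j, Z j ν, Measurable.iSup hZm, fun P hP => ?_⟩
  have := hP.isProbabilityMeasure
  have hcount : ∀ j (m : Measure X), m A = ∑' n, m (A ∩ C j n) := by
    intro j m
    rw [← measure_iUnion (fun a b hab => ((hCd j hab).mono Set.inter_subset_right
      Set.inter_subset_right)) (hACm j), ← Set.inter_iUnion, hCU, Set.inter_univ]
  have hZle : ∀ j ν, Z j ν ≤ Config.count A ν := by
    intro j ν
    rw [Config.count, hcount j]
    refine ENNReal.tsum_le_tsum fun n => ?_
    by_cases h : Config.count (A ∩ C j n) ν = 0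
    · rw [Set.indicator_of_notMem (by simpa [void] using h)]
      exact zero_le
    · rw [Set.indicator_of_mem (by simpa [void] using h)]
      exact Config.one_le_count (hACm j n) h
  have hZint : ∀ j : ℕ, μ A ≤ (1 + ((j : ℝ≥0∞) + 1)⁻¹) * ∫⁻ ν, Z j ν ∂P := by
    intro j
    rw [lintegral_tsum fun n => (measurable_one.indicator
      (measurableSet_void (hACm j n)).compl).aemeasurable, hcount j μ, ← ENNReal.tsum_mul_left]
    refine ENNReal.tsum_le_tsum fun n => ?_
    rw [lintegral_indicator_one (measurableSet_void (hACm j n)).compl,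
      prob_compl_eq_one_sub (measurableSet_void (hACm j n)), hP.measure_void (hACm j n)]
    exact le_one_add_mul_one_sub_expNeg (ENNReal.inv_ne_top.mpr (by simp)) (hCε j n)
  have hmain : μ A ≤ ∫⁻ ν, ⨆ j, Z j ν ∂P := by
    have hlim : Tendsto (fun j : ℕ => (1 + ((j : ℝ≥0∞) + 1)⁻¹) * ∫⁻ ν, ⨆ j, Z j ν ∂P) atTop
        (𝓝 ((1 + 0) * ∫⁻ ν, ⨆ j, Z j ν ∂P)) := by
      refine ENNReal.Tendsto.mul_const (tendsto_const_nhds.add ?_) (Or.inl (by simp))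
      have := (tendsto_add_atTop_iff_nat 1).mpr ENNReal.tendsto_inv_nat_nhds_zero
      simpa using this
    rw [add_zero, one_mul] at hlim
    refine ge_of_tendsto' hlim fun j => (hZint j).trans ?_
    gcongr with ν
    exact le_iSup (fun j => Z j ν) j
  have hZm' : Measurable fun ν => ⨆ j, Z j ν := (Measurable.iSup hZm).mono voidAlgebra_le le_rfl
  refine (ae_eq_of_ae_le_of_lintegral_le (Eventually.of_forall fun ν => iSup_le fun j => hZle j ν)
    ?_ (Config.measurable_count hA).aemeasurable ?_).symm
  · exact ((lintegral_mono fun ν => iSup_le fun j => hZle j ν).trans_lt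
      ((hP.lintegral_count hA hμA).trans_lt hμA)).ne
  · exact (hP.lintegral_count hA hμA).trans_le hmain

theorem exists_count_ae_eq [StandardBorelSpace X] [SigmaFinite μ]
    [NullSingletonClass μ] {A : Set X} (hA : MeasurableSet A) :
    ∃ Z : Config X → ℝ≥0∞, Measurable[voidAlgebra μ] Z ∧
      ∀ P : Measure (Config X), IsPoissonMeasure μ P → Config.count A =ᵐ[P] Z := by
  let S := disjointed (spanningSets μ)
  have hS : ∀ n, MeasurableSet (S n) := MeasurableSet.disjointed (measurableSet_spanningSets μ)
  have hSμ : ∀ n, μ (A ∩ S n) < ∞ := fun n => (measure_mono (Set.inter_subset_right.trans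
    (disjointed_subset _ n))).trans_lt (measure_spanningSets_lt_top μ n)
  choose Z hZm hZ using fun n => exists_count_ae_eq_of_lt_top (hA.inter (hS n)) (hSμ n)
  refine ⟨fun ν => ∑' n, Z n ν, measurable_tsum_ennreal hZm, fun P hP => ?_⟩
  filter_upwards [ae_all_iff.mpr fun n => hZ n P hP] with ν hν
  simp_rw [← hν]
  calc Config.count A ν = ν.1 (⋃ n, A ∩ S n) := by
        rw [← Set.inter_iUnion, iUnion_disjointed, iUnion_spanningSets, Set.inter_univ]
        rfl
    _ = ∑' n, Config.count (A ∩ S n) ν :=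
        measure_iUnion (fun a b hab => ((disjoint_disjointed _ hab).mono
          Set.inter_subset_right Set.inter_subset_right)) fun n => hA.inter (hS n)

/-- The sets with this property form a σ-algebra that makes every count measurable. One `D'` serves
all Poisson measures, so that two of them can be compared in `IsPoissonMeasure.unique`. -/
theorem exists_voidAlgebra_ae_eq [StandardBorelSpace X] [SigmaFinite μ]
    [NullSingletonClass μ] {D : Set (Config X)} (hD : MeasurableSet D) :
    ∃ D', MeasurableSet[voidAlgebra μ] D' ∧
      ∀ P : Measure (Config X), IsPoissonMeasure μ P → D =ᵐ[P] D' := by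
  let m : MeasurableSpace (Config X) :=
    { MeasurableSet' := fun D => ∃ D', MeasurableSet[voidAlgebra μ] D' ∧
        ∀ P : Measure (Config X), IsPoissonMeasure μ P → D =ᵐ[P] D'
      measurableSet_empty := ⟨∅, @MeasurableSet.empty _ (voidAlgebra μ), fun P _ => ae_eq_refl _⟩
      measurableSet_compl := fun D ⟨D', h, h'⟩ => ⟨D'ᶜ, h.compl, fun P hP => (h' P hP).compl⟩
      measurableSet_iUnion := fun D hD => by
        choose D' h h' using hD
        exact ⟨⋃ i, D' i, MeasurableSet.iUnion h, fun P hP =>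
          Filter.EventuallyEq.countable_iUnion fun i => h' i P hP⟩ }
  have hm : Config.instMeasurableSpace ≤ m := by
    refine iSup_le fun A => ?_
    rintro _ ⟨E, hE, rfl⟩
    obtain ⟨Z, hZ, hZ'⟩ := exists_count_ae_eq (μ := μ) A.2
    exact ⟨Z ⁻¹' E, hZ hE, fun P hP => (hZ' P hP).preimage E⟩
  exact hm D hD

theorem isPiSystem_void :
    IsPiSystem {s : Set (Config X) | ∃ A, MeasurableSet A ∧ μ A < ∞ ∧ s = void A} := by
  rintro _ ⟨A, hA, hμA, rfl⟩ _ ⟨B, hB, hμB, rfl⟩ -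
  exact ⟨A ∪ B, hA.union hB, measure_union_lt_top hμA hμB, void_inter_void A B⟩

/-- A function is determined by its integrals over the void events. -/
theorem IsPoissonMeasure.ae_eq_zero_of_setIntegral_void [StandardBorelSpace X] [SigmaFinite μ]
    [NullSingletonClass μ] (hP : IsPoissonMeasure μ P) {g : Config X → ℝ} (hg : Integrable g P)
    (h : ∀ A, MeasurableSet A → μ A < ∞ → ∫ ν in void A, g ν ∂P = 0) : g =ᵐ[P] 0 := by
  have huniv : ∫ ν, g ν ∂P = 0 := by
    simpa [void_empty] using h ∅ MeasurableSet.empty (by simp)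
  have key : ∀ D, MeasurableSet[voidAlgebra μ] D → ∫ ν in D, g ν ∂P = 0 := by
    intro D hD
    induction D, hD using MeasurableSpace.induction_on_inter rfl (isPiSystem_void (μ := μ)) with
    | empty => simp
    | basic D hD =>
      obtain ⟨A, hA, hμA, rfl⟩ := hD
      exact h A hA hμA
    | compl D hD ih => rw [setIntegral_compl (voidAlgebra_le _ hD) hg, ih, huniv, sub_zero]
    | iUnion D hd hD ih =>
      rw [integral_iUnion (fun i => voidAlgebra_le _ (hD i)) hd hg.integrableOn]
      simp [ih]
  refine hg.ae_eq_zero_of_forall_setIntegral_eq_zero fun D hD _ => ?_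
  obtain ⟨D', hD', hDD'⟩ := exists_voidAlgebra_ae_eq (μ := μ) hD
  rw [setIntegral_congr_set (hDD' P hP), key D' hD']

theorem IsPoissonMeasure.ae_eq_of_setIntegral_void [StandardBorelSpace X] [SigmaFinite μ]
    [NullSingletonClass μ] (hP : IsPoissonMeasure μ P) {g g' : Config X → ℝ}
    (hg : Integrable g P) (hg' : Integrable g' P)
    (h : ∀ A, MeasurableSet A → μ A < ∞ → ∫ ν in void A, g ν ∂P = ∫ ν in void A, g' ν ∂P) :
    g =ᵐ[P] g' := by
  rw [← sub_ae_eq_zero]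
  refine hP.ae_eq_zero_of_setIntegral_void (hg.sub hg') fun A hA hμA => ?_
  simp only [Pi.sub_apply]
  rw [integral_sub hg.integrableOn hg'.integrableOn, h A hA hμA, sub_self]

theorem IsPoissonMeasure.unique [StandardBorelSpace X] [SigmaFinite μ]
    [NullSingletonClass μ] {P' : Measure (Config X)} (hP : IsPoissonMeasure μ P)
    (hP' : IsPoissonMeasure μ P') : P = P' := by
  have := hP.isProbabilityMeasure
  have := hP'.isProbabilityMeasure
  have key : ∀ D, MeasurableSet[voidAlgebra μ] D → P D = P' D := by
    intro D hD
    induction D, hD using MeasurableSpace.induction_on_inter rfl (isPiSystem_void (μ := μ)) with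
    | empty => simp
    | basic D hD =>
      obtain ⟨A, hA, hμA, rfl⟩ := hD
      rw [hP.measure_void hA, hP'.measure_void hA]
    | compl D hD ih =>
      rw [prob_compl_eq_one_sub (voidAlgebra_le _ hD), prob_compl_eq_one_sub (voidAlgebra_le _ hD),
        ih]
    | iUnion D hd hD ih =>
      rw [measure_iUnion hd fun i => voidAlgebra_le _ (hD i),
        measure_iUnion hd fun i => voidAlgebra_le _ (hD i)]
      simp [ih]
  ext D hD
  obtain ⟨D', hD', hDD'⟩ := exists_voidAlgebra_ae_eq (μ := μ) hD
  rw [measure_congr (hDD' P hP), measure_congr (hDD' P' hP'), key D' hD']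

/-! ### Invariance of the Poisson measure under the induced action. -/

section Action

variable {G : Type*} [Group G] [MulAction G X] [MeasurableConstSMul G X]

theorem Config.measurable_smul (g : G) : Measurable fun ν : Config X => g • ν :=
  Config.measurable_of_count fun A hA => by
    simp_rw [Config.count_smul g _ hA]
    exact Config.measurable_count (measurable_const_smul g hA)

theorem smul_preimage_void (g : G) {A : Set X} (hA : MeasurableSet A) :
    (fun ν : Config X => g • ν) ⁻¹' void A = void ((g • ·) ⁻¹' A) := by
  ext ν
  simp only [void, Set.mem_preimage, Set.mem_ofPred_eq, Config.count_smul g _ hA]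

/-- Since `μ` is invariant, the image of `P` again satisfies the defining property of the Poisson
measure over `μ`; uniqueness concludes. -/
theorem IsPoissonMeasure.measurePreserving_smul [StandardBorelSpace X] [SigmaFinite μ]
    [NullSingletonClass μ] [SMulInvariantMeasure G X μ] (hP : IsPoissonMeasure μ P) (g : G) :
    MeasurePreserving (fun ν : Config X => g • ν) P P := by
  refine ⟨Config.measurable_smul g, IsPoissonMeasure.unique (μ := μ) ⟨?_, ?_⟩ hP⟩
  · have := hP.isProbabilityMeasure
    exact Measure.isProbabilityMeasure_map (Config.measurable_smul g).aemeasurable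
  · intro k A hA hμA hd
    have hA' : ∀ i, MeasurableSet ((g • ·) ⁻¹' A i) := fun i => measurable_const_smul g (hA i)
    have hμ : ∀ i, μ ((g • ·) ⁻¹' A i) = μ (A i) := fun i =>
      SMulInvariantMeasure.measure_preimage_smul g (hA i)
    have hcomp : ∀ i, Config.count (A i) ∘ (fun ν : Config X => g • ν) =
        Config.count ((g • ·) ⁻¹' A i) := fun i => funext fun ν => Config.count_smul g ν (hA i)
    obtain ⟨h1, h2⟩ := hP.law k (fun i => (g • ·) ⁻¹' A i) hA' (fun i => by rw [hμ i]; exact hμA i)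
      fun i j hij => (hd hij).preimage _
    have hcm : ∀ i, Measurable (Config.count (A i)) := fun i => Config.measurable_count (hA i)
    refine ⟨?_, fun i => ?_⟩
    · have := hP.isProbabilityMeasure
      rw [iIndepFun_iff_measure_inter_preimage_eq_mul] at h1 ⊢
      intro S E hE
      rw [Measure.map_apply (Config.measurable_smul g)
        (Finset.measurableSet_biInter _ fun i hi => hcm i (hE i hi)), Set.preimage_iInter₂]
      simp_rw [← Set.preimage_comp, hcomp]
      rw [h1 S hE]
      refine Finset.prod_congr rfl fun i hi => ?_
      rw [Measure.map_apply (Config.measurable_smul g) (hcm i (hE i hi)), ← Set.preimage_comp,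
        hcomp]
    · rw [Measure.map_map (hcm i) (Config.measurable_smul g), hcomp, h2 i, hμ i]

end Action

end Void

/-! ### Infinite divisibility and the logarithmic correlation of void events. -/

/-- Here `x k = a ^ (1 / k)`, so the sequence is minus the difference quotient at `0` of `t ↦ a ^
t`, with step `1 / k`. -/
theorem tendsto_mul_one_sub_of_pow_eq {x : ℕ → ℝ} {a : ℝ} (ha : 0 < a)
    (hx : ∀ k, 1 ≤ k → 0 ≤ x k) (hxa : ∀ k, 1 ≤ k → x k ^ k = a) :
    Tendsto (fun k : ℕ => (k : ℝ) * (1 - x k)) atTop (𝓝 (-Real.log a)) := by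
  have h1 : HasDerivAt (fun t : ℝ => Real.exp (Real.log a * t)) (Real.log a) 0 := by
    simpa using ((hasDerivAt_id (0 : ℝ)).const_mul (Real.log a)).exp
  have h2 := h1.tendsto_slope_zero_right
  have h3 : Tendsto (fun k : ℕ => (k : ℝ)⁻¹) atTop (𝓝[>] 0) :=
    tendsto_inv_atTop_nhdsGT_zero.comp tendsto_natCast_atTop_atTop
  refine ((h2.comp h3).neg).congr' ?_
  filter_upwards [eventually_ge_atTop 1] with k hk
  have hk0 : (k : ℝ) ≠ 0 := by positivity
  have hxk : x k = Real.exp (Real.log a * (k : ℝ)⁻¹) := by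
    rw [← Real.rpow_def_of_pos ha, ← hxa k hk, Real.pow_rpow_inv_natCast (hx k hk) (by omega)]
  simp only [Function.comp_apply, zero_add, inv_inv, smul_eq_mul, mul_zero, Real.exp_zero]
  rw [hxk]
  ring

section Pairing

variable {X : Type*} [MeasurableSpace X]

/-- A symmetric nonnegative function of two sets of finite measure, finitely additive in each
variable and dominated by `μ` in each variable. -/
structure IsPairing (μ : Measure X) (m : Set X → Set X → ℝ) : Prop where
  symm : ∀ A B, MeasurableSet A → MeasurableSet B → m A B = m B A
  nonneg : ∀ A B, MeasurableSet A → MeasurableSet B → μ A < ∞ → μ B < ∞ → 0 ≤ m A B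
  le : ∀ A B, MeasurableSet A → MeasurableSet B → μ A < ∞ → μ B < ∞ → m A B ≤ μ.real B
  add : ∀ A B C, MeasurableSet A → MeasurableSet B → MeasurableSet C → μ A < ∞ → μ B < ∞ →
    μ C < ∞ → Disjoint B C → m A (B ∪ C) = m A B + m A C

/-- The logarithmic correlation of the void events of `A` and `B` under the joining `J`. -/
noncomputable def voidPairing (μ : Measure X) (J : Measure (Config X × Config X)) (A B : Set X) :
    ℝ :=
  μ.real A + μ.real B + Real.log (J.real (void A ×ˢ void B))

variable {μ : Measure X} {J : Measure (Config X × Config X)}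

theorem void_sum {k : ℕ} (A : Set X) (x : Fin k → Config X) :
    ∑ i, x i ∈ void A ↔ ∀ i, x i ∈ void A := by
  have h : ∀ s : Finset (Fin k), ∑ i ∈ s, x i ∈ void A ↔ ∀ i ∈ s, x i ∈ void A := by
    intro s
    induction s using Finset.induction_on with
    | empty => simpa using (show (0 : Config X) ∈ void A from by simp [void, Config.count]; rfl)
    | insert i s hi ih =>
      rw [Finset.sum_insert hi, Finset.forall_mem_insert, ← ih]
      exact add_eq_zero
  simpa using h Finset.univ

/-- A sum of configurations avoids a set iff each summand does, so under a `k`-fold convolution void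
probabilities are raised to the power `k`. -/
theorem IsInfinitelyDivisible.exists_roots (hJ : IsInfinitelyDivisible J) :
    ∃ q : ℕ → Measure (Config X × Config X), ∀ k, 1 ≤ k → IsProbabilityMeasure (q k) ∧
      ∀ A B, MeasurableSet A → MeasurableSet B →
        (q k).real (void A ×ˢ void B) ^ k = J.real (void A ×ˢ void B) := by
  choose! q hq using hJ
  refine ⟨q, fun k hk => ⟨(hq k hk).1, fun A B hA hB => ?_⟩⟩
  have := (hq k hk).1
  have hpre : (fun x : Fin k → Config X × Config X => ∑ i, x i) ⁻¹' (void A ×ˢ void B) =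
      Set.univ.pi fun _ => void A ×ˢ void B := by
    ext x
    simp only [Set.mem_preimage, Set.mem_prod, Prod.fst_sum, Prod.snd_sum, void_sum,
      Set.mem_univ_pi]
    exact forall_and.symm
  have hmeas : Measurable fun x : Fin k → Config X × Config X => ∑ i, x i := by
    refine Measurable.prod ?_ ?_
    · simp_rw [Prod.fst_sum]
      exact Finset.measurable_fun_sum _ fun i _ => measurable_fst.comp (measurable_pi_apply i)
    · simp_rw [Prod.snd_sum]
      exact Finset.measurable_fun_sum _ fun i _ => measurable_snd.comp (measurable_pi_apply i)
  rw [measureReal_def, measureReal_def, ← ENNReal.toReal_pow, (hq k hk).2,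
    Measure.map_apply hmeas ((measurableSet_void hA).prod (measurableSet_void hB)), hpre,
    Measure.pi_pi]
  simp

/-- Under an infinitely divisible joining with Poisson marginals, the logarithmic correlation of
void events is finitely additive and dominated by the intensity; the joint void probabilities do
not vanish. -/
theorem isPairing_voidPairing (hJ : IsInfinitelyDivisible J)
    (hsymm : ∀ A B, MeasurableSet A → MeasurableSet B →
      J.real (void A ×ˢ void B) = J.real (void B ×ˢ void A))
    (hmarg : ∀ A, MeasurableSet A → μ A < ∞ →
      J.real (void A ×ˢ void ∅) = Real.exp (-μ.real A)) :
    IsPairing μ (voidPairing μ J) ∧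
      ∀ A B, MeasurableSet A → MeasurableSet B → μ A < ∞ → μ B < ∞ →
        0 < J.real (void A ×ˢ void B) := by
  obtain ⟨q, hq⟩ := hJ.exists_roots
  -- the probability of meeting `A` in the first coordinate and `B` in the second one
  let r : ℕ → Set X → Set X → ℝ := fun k A B => (q k).real (void A ×ˢ void B)
  let o : ℕ → Set X → Set X → ℝ := fun k A B => (q k).real ((void A)ᶜ ×ˢ (void B)ᶜ)
  have hr : ∀ k, 1 ≤ k → ∀ A B, MeasurableSet A → MeasurableSet B →
      r k A B ^ k = J.real (void A ×ˢ void B) := fun k hk => (hq k hk).2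
  have hr0 : ∀ k A B, 0 ≤ r k A B := fun k A B => measureReal_nonneg
  have ho : ∀ k, 1 ≤ k → ∀ A B, MeasurableSet A → MeasurableSet B →
      o k A B = (1 - r k A ∅) + (1 - r k ∅ B) - (1 - r k A B) := by
    intro k hk A B hA hB
    have := (hq k hk).1
    have hVA := measurableSet_void hA
    have hVB := measurableSet_void hB
    have h1 : (q k).real ((void A)ᶜ ×ˢ (Set.univ : Set (Config X))) = 1 - r k A ∅ := by
      have : (void A)ᶜ ×ˢ (Set.univ : Set (Config X)) = (void A ×ˢ void (∅ : Set X))ᶜ := by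
        ext; simp [void_empty]
      rw [this, probReal_compl_eq_one_sub (hVA.prod (measurableSet_void MeasurableSet.empty))]
    have h2 : (q k).real ((void A)ᶜ ×ˢ (void B)) = r k ∅ B - r k A B := by
      have : (void A)ᶜ ×ˢ (void B) = (void (∅ : Set X) ×ˢ void B) \ (void A ×ˢ void B) := by
        ext ⟨a, b⟩; simp [void_empty]; tauto
      rw [this, measureReal_sdiff (Set.prod_mono (by simp [void_empty]) le_rfl) (hVA.prod hVB)]
    have h3 : o k A B = (q k).real ((void A)ᶜ ×ˢ (Set.univ : Set (Config X))) -
        (q k).real ((void A)ᶜ ×ˢ (void B)) := by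
      have : (void A)ᶜ ×ˢ (void B)ᶜ = ((void A)ᶜ ×ˢ (Set.univ : Set (Config X))) \
          ((void A)ᶜ ×ˢ void B) := by
        ext ⟨a, b⟩; simp; tauto
      simp only [o]
      rw [this, measureReal_sdiff (Set.prod_mono le_rfl (Set.subset_univ _)) (hVA.compl.prod hVB)]
    rw [h3, h1, h2]
    ring
  have ho0 : ∀ k A B, 0 ≤ o k A B := fun k A B => measureReal_nonneg
  have hlim1 : ∀ A, MeasurableSet A → μ A < ∞ →
      Tendsto (fun k : ℕ => (k : ℝ) * (1 - r k A ∅)) atTop (𝓝 (μ.real A)) := by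
    intro A hA hμA
    have := tendsto_mul_one_sub_of_pow_eq (x := fun k => r k A ∅) (Real.exp_pos (-μ.real A))
      (fun k _ => hr0 k A ∅)
      (fun k hk => (hr k hk A ∅ hA MeasurableSet.empty).trans (hmarg A hA hμA))
    simpa using this
  have hlim2 : ∀ A, MeasurableSet A → μ A < ∞ →
      Tendsto (fun k : ℕ => (k : ℝ) * (1 - r k ∅ A)) atTop (𝓝 (μ.real A)) := by
    intro A hA hμA
    have := tendsto_mul_one_sub_of_pow_eq (x := fun k => r k ∅ A) (Real.exp_pos (-μ.real A))
      (fun k _ => hr0 k ∅ A) (fun k hk => (hr k hk ∅ A MeasurableSet.empty hA).trans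
        ((hsymm ∅ A MeasurableSet.empty hA).trans (hmarg A hA hμA)))
    simpa using this
  -- The two marginal hitting probabilities under `q k` are `O(1 / k)`. For large `k` they sum to
  -- less than `1`, so by the union bound both sets are avoided with positive probability.
  have hpos : ∀ A B, MeasurableSet A → MeasurableSet B → μ A < ∞ → μ B < ∞ →
      0 < J.real (void A ×ˢ void B) := by
    intro A B hA hB hμA hμB
    have hsum := (hlim1 A hA hμA).add (hlim2 B hB hμB)
    obtain ⟨k, hk, hk1, hkn⟩ := ((hsum.eventually_lt_const (lt_add_one _)).and
      ((eventually_ge_atTop 1).and (tendsto_natCast_atTop_atTop.eventually_ge_atTop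
        (μ.real A + μ.real B + 1)))).exists
    have hk0 : (0 : ℝ) < k := by positivity
    have h1 : (1 - r k A ∅) + (1 - r k ∅ B) < 1 := by
      by_contra! h
      nlinarith
    have h2 : 0 < r k A B := by
      have := ho k hk1 A B hA hB
      linarith [ho0 k A B]
    rw [← hr k hk1 A B hA hB]
    positivity
  have hlim : ∀ A B, MeasurableSet A → MeasurableSet B → μ A < ∞ → μ B < ∞ →
      Tendsto (fun k : ℕ => (k : ℝ) * o k A B) atTop (𝓝 (voidPairing μ J A B)) := by
    intro A B hA hB hμA hμB
    have h3 := tendsto_mul_one_sub_of_pow_eq (hpos A B hA hB hμA hμB)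
      (fun k _ => hr0 k A B) (fun k hk => hr k hk A B hA hB)
    have h4 := ((hlim1 A hA hμA).add (hlim2 B hB hμB)).sub h3
    rw [sub_neg_eq_add] at h4
    refine h4.congr' ?_
    filter_upwards [eventually_ge_atTop 1] with k hk
    rw [ho k hk A B hA hB]
    ring
  refine ⟨⟨fun A B hA hB => ?_, fun A B hA hB hμA hμB => ?_, fun A B hA hB hμA hμB => ?_,
    fun A B C hA hB hC hμA hμB hμC hBC => ?_⟩, hpos⟩
  · rw [voidPairing, voidPairing, hsymm A B hA hB]
    ring
  · exact ge_of_tendsto' (hlim A B hA hB hμA hμB) fun k => mul_nonneg k.cast_nonneg (ho0 k A B)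
  · refine le_of_tendsto_of_tendsto (hlim A B hA hB hμA hμB) (hlim2 B hB hμB) ?_
    filter_upwards [eventually_ge_atTop 1] with k hk
    have := (hq k hk).1
    gcongr
    have h2 : (q k).real (void (∅ : Set X) ×ˢ void B)ᶜ = 1 - r k ∅ B := by
      rw [probReal_compl_eq_one_sub
        ((measurableSet_void MeasurableSet.empty).prod (measurableSet_void hB))]
    rw [← h2]
    refine measureReal_mono fun p hp => ?_
    simp only [Set.mem_prod, Set.mem_compl_iff] at hp ⊢
    tauto
  · have hVB := measurableSet_void hB
    have hVC := measurableSet_void hC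
    have hμBC : μ (B ∪ C) < ∞ := measure_union_lt_top hμB hμC
    have hlBC := hlim A (B ∪ C) hA (hB.union hC) hμA hμBC
    have hlsum := (hlim A B hA hB hμA hμB).add (hlim A C hA hC hμA hμC)
    -- the probability of meeting both `B` and `C` in the second coordinate
    let d : ℕ → ℝ := fun k => (1 - r k ∅ B) + (1 - r k ∅ C) - (1 - r k ∅ (B ∪ C))
    -- Additivity of `μ` on the disjoint sets `B` and `C` kills the limit; as `d k` bounds the
    -- defect of additivity of `o k A`, the limit is additive.
    have hd : Tendsto (fun k : ℕ => (k : ℝ) * d k) atTop (𝓝 0) := by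
      have := ((hlim2 B hB hμB).add (hlim2 C hC hμC)).sub (hlim2 (B ∪ C) (hB.union hC) hμBC)
      rw [measureReal_union hBC hC hμB.ne hμC.ne, sub_self] at this
      refine this.congr fun k => ?_
      simp only [d]
      ring
    have hkey : ∀ k, 1 ≤ k → o k A B + o k A C - d k ≤ o k A (B ∪ C) ∧
        o k A (B ∪ C) ≤ o k A B + o k A C := by
      intro k hk
      have := (hq k hk).1
      have hset : (void A)ᶜ ×ˢ (void (B ∪ C))ᶜ =
          (void A)ᶜ ×ˢ (void B)ᶜ ∪ (void A)ᶜ ×ˢ (void C)ᶜ := by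
        rw [← void_inter_void, Set.compl_inter, Set.prod_union]
      have h1 := measureReal_union_add_inter (μ := q k) (s := (void A)ᶜ ×ˢ (void B)ᶜ)
        ((measurableSet_void hA).compl.prod hVC.compl)
      rw [← hset] at h1
      have h2 : (q k).real ((void (∅ : Set X) ×ˢ void B)ᶜ ∩ (void (∅ : Set X) ×ˢ void C)ᶜ) =
          d k := by
        have hV0 := measurableSet_void (MeasurableSet.empty (α := X))
        have h3 := measureReal_union_add_inter (μ := q k) (s := (void (∅ : Set X) ×ˢ void B)ᶜ)
          (hV0.prod hVC).compl
        have h4 : (void (∅ : Set X) ×ˢ void B)ᶜ ∪ (void (∅ : Set X) ×ˢ void C)ᶜ =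
            (void (∅ : Set X) ×ˢ void (B ∪ C))ᶜ := by
          rw [← void_inter_void, ← Set.compl_inter, Set.prod_inter]
        rw [h4, probReal_compl_eq_one_sub (hV0.prod (measurableSet_void (hB.union hC))),
          probReal_compl_eq_one_sub (hV0.prod hVB), probReal_compl_eq_one_sub (hV0.prod hVC)] at h3
        simp only [d, r]
        linarith
      have h5 : (q k).real ((void A)ᶜ ×ˢ (void B)ᶜ ∩ (void A)ᶜ ×ˢ (void C)ᶜ) ≤ d k := by
        rw [← h2]
        refine measureReal_mono fun p hp => ?_
        simp only [Set.mem_inter_iff, Set.mem_prod, Set.mem_compl_iff] at hp ⊢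
        tauto
      have h6 : 0 ≤ (q k).real ((void A)ᶜ ×ˢ (void B)ᶜ ∩ (void A)ᶜ ×ˢ (void C)ᶜ) :=
        measureReal_nonneg
      simp only [o]
      constructor <;> linarith
    refine le_antisymm (le_of_tendsto_of_tendsto hlBC hlsum ?_)
      (le_of_tendsto_of_tendsto (f := fun k : ℕ => (k : ℝ) * o k A B + k * o k A C - k * d k)
        (by simpa using hlsum.sub hd) hlBC ?_)
    · filter_upwards [eventually_ge_atTop 1] with k hk
      rw [← mul_add]
      exact mul_le_mul_of_nonneg_left (hkey k hk).2 k.cast_nonneg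
    · filter_upwards [eventually_ge_atTop 1] with k hk
      rw [← mul_add, ← mul_sub]
      exact mul_le_mul_of_nonneg_left (hkey k hk).1 k.cast_nonneg

/-- A finitely additive function dominated by a `σ`-finite measure has a density. -/
theorem exists_density [SigmaFinite μ] {l : Set X → ℝ}
    (h0 : ∀ B, MeasurableSet B → μ B < ∞ → 0 ≤ l B)
    (hle : ∀ B, MeasurableSet B → μ B < ∞ → l B ≤ μ.real B)
    (hadd : ∀ B C, MeasurableSet B → MeasurableSet C → μ B < ∞ → μ C < ∞ → Disjoint B C →
      l (B ∪ C) = l B + l C) :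
    ∃ φ : X → ℝ, Measurable φ ∧ (∀ x, 0 ≤ φ x) ∧ (∀ x, φ x ≤ 1) ∧
      ∀ B, MeasurableSet B → μ B < ∞ → l B = ∫ x in B, φ x ∂μ := by
  have hl_empty : l ∅ = 0 := by
    have := hadd ∅ ∅ MeasurableSet.empty MeasurableSet.empty (by simp) (by simp) (by simp)
    simpa using this
  -- Domination upgrades finite to countable additivity: the tails of `l` are squeezed between `0`
  -- and the tails of `μ`.
  have hsigma : ∀ B : ℕ → Set X, (∀ i, MeasurableSet (B i)) →
      Pairwise (Function.onFun Disjoint B) → μ (⋃ i, B i) < ∞ →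
      ENNReal.ofReal (l (⋃ i, B i)) = ∑' i, ENNReal.ofReal (l (B i)) := by
    intro B hB hd hμ
    have hBμ : ∀ i, μ (B i) < ∞ := fun i => (measure_mono (Set.subset_iUnion B i)).trans_lt hμ
    have hsub : ∀ n, ⋃ i < n, B i ⊆ ⋃ i, B i := fun n => Set.iUnion₂_subset_iUnion _ _
    have hfm : ∀ n, MeasurableSet (⋃ i < n, B i) := fun n =>
      MeasurableSet.iUnion fun i => MeasurableSet.iUnion fun _ => hB i
    have hfμ : ∀ n, μ (⋃ i < n, B i) < ∞ := fun n => (measure_mono (hsub n)).trans_lt hμ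
    have hfin : ∀ n, l (⋃ i < n, B i) = ∑ i ∈ Finset.range n, l (B i) := by
      intro n
      induction n with
      | zero => simp [hl_empty]
      | succ n ih =>
        rw [Finset.sum_range_succ, ← ih, Set.biUnion_lt_succ,
          hadd _ _ (hfm n) (hB n) (hfμ n) (hBμ n)]
        simp only [Set.disjoint_iUnion_left]
        exact fun i hi => hd hi.ne
    have hsumμ : HasSum (fun i => μ.real (B i)) (μ.real (⋃ i, B i)) := by
      rw [measureReal_def, measure_iUnion hd hB, ENNReal.tsum_toReal_eq fun i => (hBμ i).ne]
      refine (ENNReal.summable_toReal ?_).hasSum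
      rw [← measure_iUnion hd hB]
      exact hμ.ne
    have htail : ∀ n, l (⋃ i, B i) - ∑ i ∈ Finset.range n, l (B i) ≤
        μ.real (⋃ i, B i) - ∑ i ∈ Finset.range n, μ.real (B i) := by
      intro n
      have hdm : MeasurableSet ((⋃ i, B i) \ ⋃ i < n, B i) :=
        (MeasurableSet.iUnion hB).diff (hfm n)
      have hdμ : μ ((⋃ i, B i) \ ⋃ i < n, B i) < ∞ :=
        (measure_mono Set.sdiff_subset).trans_lt hμ
      have h1 := hadd _ _ (hfm n) hdm (hfμ n) hdμ Set.disjoint_sdiff_right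
      have h2 := measureReal_union (Set.disjoint_sdiff_right (s := ⋃ i < n, B i)
        (t := ⋃ i, B i)) hdm (hfμ n).ne hdμ.ne
      rw [Set.union_sdiff_cancel (hsub n)] at h1 h2
      have h3 : μ.real (⋃ i < n, B i) = ∑ i ∈ Finset.range n, μ.real (B i) := by
        have h4 := measureReal_biUnion_finset (μ := μ) (s := Finset.range n) (f := B)
          (fun i _ j _ hij => hd hij) (fun i _ => hB i) (fun i _ => (hBμ i).ne)
        rw [← h4]
        simp
      rw [h1, h2, hfin, h3]
      linarith [hle _ hdm hdμ]
    have htail0 : ∀ n, 0 ≤ l (⋃ i, B i) - ∑ i ∈ Finset.range n, l (B i) := by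
      intro n
      have hdm : MeasurableSet ((⋃ i, B i) \ ⋃ i < n, B i) :=
        (MeasurableSet.iUnion hB).diff (hfm n)
      have hdμ : μ ((⋃ i, B i) \ ⋃ i < n, B i) < ∞ :=
        (measure_mono Set.sdiff_subset).trans_lt hμ
      have h1 := hadd _ _ (hfm n) hdm (hfμ n) hdμ Set.disjoint_sdiff_right
      rw [Set.union_sdiff_cancel (hsub n)] at h1
      rw [h1, hfin]
      linarith [h0 _ hdm hdμ]
    have hlim : Tendsto (fun n => ∑ i ∈ Finset.range n, l (B i)) atTop (𝓝 (l (⋃ i, B i))) := by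
      have h1 : Tendsto (fun n => l (⋃ i, B i) - ∑ i ∈ Finset.range n, l (B i)) atTop (𝓝 0) := by
        refine squeeze_zero htail0 htail ?_
        simpa using (tendsto_const_nhds (x := μ.real (⋃ i, B i))).sub hsumμ.tendsto_sum_nat
      simpa using (tendsto_const_nhds (x := l (⋃ i, B i))).sub h1
    have hsum := (hasSum_iff_tendsto_nat_of_nonneg (fun i => h0 _ (hB i) (hBμ i)) _).mpr hlim
    rw [← hsum.tsum_eq, ENNReal.ofReal_tsum_of_nonneg (fun i => h0 _ (hB i) (hBμ i)) hsum.summable]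
  let S := disjointed (spanningSets μ)
  have hS : ∀ n, MeasurableSet (S n) := MeasurableSet.disjointed (measurableSet_spanningSets μ)
  have hSd : Pairwise (Function.onFun Disjoint S) := disjoint_disjointed _
  have hSU : ⋃ n, S n = Set.univ := by rw [iUnion_disjointed, iUnion_spanningSets]
  have hSμ : ∀ B n, μ (B ∩ S n) < ∞ := fun B n => (measure_mono (Set.inter_subset_right.trans
    (disjointed_subset _ n))).trans_lt (measure_spanningSets_lt_top μ n)
  -- Only the values of `l` on sets of finite measure are controlled, so `B` is cut into such
  -- pieces.
  let lam : Measure X := Measure.ofMeasurable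
    (fun B _ => ∑' n, ENNReal.ofReal (l (B ∩ S n))) (by simp [hl_empty]) (by
      intro B hB hd
      rw [ENNReal.tsum_comm]
      refine tsum_congr fun n => ?_
      rw [Set.iUnion_inter, hsigma _ (fun i => (hB i).inter (hS n))
        (fun i j hij => (hd hij).mono Set.inter_subset_left Set.inter_subset_left)]
      rw [← Set.iUnion_inter]
      exact hSμ _ n)
  have hlam : ∀ B, MeasurableSet B → lam B = ∑' n, ENNReal.ofReal (l (B ∩ S n)) := fun B hB =>
    Measure.ofMeasurable_apply B hB
  have hpieces : ∀ B, B = ⋃ n, B ∩ S n := fun B => by rw [← Set.inter_iUnion, hSU, Set.inter_univ]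
  have hpd : ∀ B, Pairwise (Function.onFun Disjoint fun n => B ∩ S n) := fun B i j hij =>
    (hSd hij).mono Set.inter_subset_right Set.inter_subset_right
  have hlam_fin : ∀ B, MeasurableSet B → μ B < ∞ → lam B = ENNReal.ofReal (l B) := by
    intro B hB hμB
    rw [hlam B hB, ← hsigma _ (fun n => hB.inter (hS n)) (hpd B) (by rwa [← hpieces B]),
      ← hpieces B]
  have hlam_le : lam ≤ μ := by
    refine Measure.le_iff.mpr fun B hB => ?_
    rw [hlam B hB]
    conv_rhs => rw [hpieces B, measure_iUnion (hpd B) fun n => hB.inter (hS n)]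
    refine ENNReal.tsum_le_tsum fun n => ?_
    exact ENNReal.ofReal_le_of_le_toReal (hle _ (hB.inter (hS n)) (hSμ B n))
  have hac : lam ≪ μ := Measure.absolutelyContinuous_of_le hlam_le
  have hsf : SigmaFinite lam := by
    refine ⟨⟨⟨spanningSets μ, fun _ => trivial, fun n => ?_, iUnion_spanningSets μ⟩⟩⟩
    exact (hlam_le _).trans_lt (measure_spanningSets_lt_top μ n)
  have hone := Measure.rnDeriv_le_one_of_le hlam_le
  -- Truncation at `1` changes the density only on a null set and makes the bound hold everywhere.
  refine ⟨fun x => (min (lam.rnDeriv μ x) 1).toReal, by fun_prop,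
    fun x => ENNReal.toReal_nonneg, fun x => ?_, fun B hB hμB => ?_⟩
  · exact ENNReal.toReal_mono ENNReal.one_ne_top (min_le_right _ _)
  · have h1 : ∫ x in B, (min (lam.rnDeriv μ x) 1).toReal ∂μ =
        ∫ x in B, (lam.rnDeriv μ x).toReal ∂μ := by
      refine integral_congr_ae (ae_restrict_of_ae ?_)
      filter_upwards [hone] with x hx
      rw [min_eq_left (show lam.rnDeriv μ x ≤ 1 from hx)]
    rw [h1, Measure.setIntegral_toReal_rnDeriv hac B, measureReal_def, hlam_fin B hB hμB,
      ENNReal.toReal_ofReal (h0 B hB hμB)]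

end Pairing

/-! ### Fixed functions and fixed sets of a symmetric sub-Markov operator. -/

section Fixed

variable {X : Type*} [MeasurableSpace X]

/-- The images `φ A` of the indicators of the sets `A` of finite measure under a symmetric
sub-Markov operator. -/
structure IsSubMarkov (μ : Measure X) (φ : Set X → X → ℝ) : Prop where
  measurable : ∀ A, MeasurableSet A → μ A < ∞ → Measurable (φ A)
  nonneg : ∀ A, MeasurableSet A → μ A < ∞ → ∀ x, 0 ≤ φ A x
  le_one : ∀ A, MeasurableSet A → μ A < ∞ → ∀ x, φ A x ≤ 1
  integrable : ∀ A, MeasurableSet A → μ A < ∞ → Integrable (φ A) μ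
  integral_le : ∀ A, MeasurableSet A → μ A < ∞ → ∫ x, φ A x ∂μ ≤ μ.real A
  add : ∀ A B, MeasurableSet A → MeasurableSet B → μ A < ∞ → μ B < ∞ → Disjoint A B →
    φ (A ∪ B) =ᵐ[μ] fun x => φ A x + φ B x

/-- The integrable functions fixed by the operator that maps `1_B` to `φ B`. -/
structure IsFixed (μ : Measure X) (φ : Set X → X → ℝ) (f : X → ℝ) : Prop where
  measurable : Measurable f
  integrable : Integrable f μ
  eq : ∀ B, MeasurableSet B → μ B < ∞ → ∫ x in B, f x ∂μ = ∫ x, f x * φ B x ∂μ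

variable {μ : Measure X} {φ : Set X → X → ℝ}

theorem IsSubMarkov.integrable_mul (hφ : IsSubMarkov μ φ) {f : X → ℝ} (hf : Integrable f μ)
    {B : Set X} (hB : MeasurableSet B) (hμB : μ B < ∞) : Integrable (fun x => f x * φ B x) μ :=
  hf.mul_bdd (c := 1) (hφ.measurable B hB hμB).aestronglyMeasurable
    (Eventually.of_forall fun x => by
      rw [Real.norm_of_nonneg (hφ.nonneg B hB hμB x)]
      exact hφ.le_one B hB hμB x)

theorem IsFixed.sub (hφ : IsSubMarkov μ φ) {f g : X → ℝ} (hf : IsFixed μ φ f)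
    (hg : IsFixed μ φ g) : IsFixed μ φ fun x => f x - g x := by
  refine ⟨hf.measurable.sub hg.measurable, hf.integrable.sub hg.integrable, fun B hB hμB => ?_⟩
  simp_rw [sub_mul]
  rw [integral_sub hf.integrable.integrableOn hg.integrable.integrableOn,
    integral_sub (hφ.integrable_mul hf.integrable hB hμB)
      (hφ.integrable_mul hg.integrable hB hμB), hf.eq B hB hμB, hg.eq B hB hμB]

theorem IsFixed.add (hφ : IsSubMarkov μ φ) {f g : X → ℝ} (hf : IsFixed μ φ f)
    (hg : IsFixed μ φ g) : IsFixed μ φ fun x => f x + g x := by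
  refine ⟨hf.measurable.add hg.measurable, hf.integrable.add hg.integrable, fun B hB hμB => ?_⟩
  simp_rw [add_mul]
  rw [integral_add hf.integrable.integrableOn hg.integrable.integrableOn,
    integral_add (hφ.integrable_mul hf.integrable hB hμB)
      (hφ.integrable_mul hg.integrable hB hμB), hf.eq B hB hμB, hg.eq B hB hμB]

theorem IsFixed.const_mul {f : X → ℝ} (hf : IsFixed μ φ f) (c : ℝ) :
    IsFixed μ φ fun x => c * f x := by
  refine ⟨hf.measurable.const_mul c, hf.integrable.const_mul c, fun B hB hμB => ?_⟩
  simp_rw [mul_assoc]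
  rw [integral_const_mul, integral_const_mul, hf.eq B hB hμB]

theorem IsFixed.congr {f g : X → ℝ} (hf : IsFixed μ φ f) (hg : Measurable g) (h : f =ᵐ[μ] g) :
    IsFixed μ φ g := by
  refine ⟨hg, hf.integrable.congr h, fun B hB hμB => ?_⟩
  rw [← integral_congr_ae (ae_restrict_of_ae h), hf.eq B hB hμB]
  refine integral_congr_ae ?_
  filter_upwards [h] with x hx
  rw [hx]

theorem IsFixed.of_tendsto (hφ : IsSubMarkov μ φ) {f : ℕ → X → ℝ} {g b : X → ℝ}
    (hf : ∀ n, IsFixed μ φ (f n)) (hb : Integrable b μ) (hfb : ∀ n x, |f n x| ≤ b x)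
    (hlim : ∀ x, Tendsto (fun n => f n x) atTop (𝓝 (g x))) : IsFixed μ φ g := by
  have hg : Measurable g := measurable_of_tendsto_metrizable (fun n => (hf n).measurable)
    (tendsto_pi_nhds.mpr hlim)
  have hgb : ∀ x, |g x| ≤ b x := fun x => le_of_tendsto' (hlim x).abs fun n => hfb n x
  refine ⟨hg, hb.mono' hg.aestronglyMeasurable (Eventually.of_forall hgb), fun B hB hμB => ?_⟩
  have h1 : Tendsto (fun n => ∫ x in B, f n x ∂μ) atTop (𝓝 (∫ x in B, g x ∂μ)) :=
    tendsto_integral_of_dominated_convergence b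
      (fun n => (hf n).measurable.aestronglyMeasurable) hb.integrableOn
      (fun n => Eventually.of_forall (hfb n)) (Eventually.of_forall hlim)
  have h2 : Tendsto (fun n => ∫ x, f n x * φ B x ∂μ) atTop (𝓝 (∫ x, g x * φ B x ∂μ)) := by
    refine tendsto_integral_of_dominated_convergence b
      (fun n => (hφ.integrable_mul (hf n).integrable hB hμB).aestronglyMeasurable) hb
      (fun n => Eventually.of_forall fun x => ?_)
      (Eventually.of_forall fun x => (hlim x).mul_const _)
    rw [norm_mul, Real.norm_of_nonneg (hφ.nonneg B hB hμB x)]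
    calc ‖f n x‖ * φ B x ≤ b x * 1 := by
          gcongr
          · exact hφ.nonneg B hB hμB x
          · exact (abs_nonneg _).trans (hfb n x)
          · exact hfb n x
          · exact hφ.le_one B hB hμB x
      _ = b x := mul_one _
  refine tendsto_nhds_unique h1 (h2.congr fun n => ((hf n).eq B hB hμB).symm)

theorem IsSubMarkov.mono (hφ : IsSubMarkov μ φ) {A B : Set X} (hA : MeasurableSet A)
    (hB : MeasurableSet B) (hμB : μ B < ∞) (hAB : A ⊆ B) : φ A ≤ᵐ[μ] φ B := by
  have hd : MeasurableSet (B \ A) := hB.diff hA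
  have hμd : μ (B \ A) < ∞ := (measure_mono Set.sdiff_subset).trans_lt hμB
  have := hφ.add A (B \ A) hA hd ((measure_mono hAB).trans_lt hμB) hμd Set.disjoint_sdiff_right
  rw [Set.union_sdiff_cancel hAB] at this
  filter_upwards [this] with x hx
  rw [hx]
  linarith [hφ.nonneg _ hd hμd x]

/-- A nonnegative function which is below its image is fixed. -/
theorem IsSubMarkov.isFixed_of_le [SigmaFinite μ] (hφ : IsSubMarkov μ φ) {g : X → ℝ}
    (hgm : Measurable g) (hg : Integrable g μ) (hg0 : ∀ x, 0 ≤ g x)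
    (hle : ∀ B, MeasurableSet B → μ B < ∞ → ∫ x in B, g x ∂μ ≤ ∫ x, g x * φ B x ∂μ) :
    IsFixed μ φ g := by
  refine ⟨hgm, hg, fun B hB hμB => le_antisymm (hle B hB hμB) ?_⟩
  -- The gain on `B` is bounded by the mass of `g` outside `S`: the gain on `S \ B` is nonnegative,
  -- and as `φ (B ∪ S \ B) ≤ 1` the image of `g` has mass at most `∫ g` on the union.
  have hkey : ∀ n, ∫ x, g x * φ B x ∂μ - ∫ x in B, g x ∂μ ≤
      ∫ x, g x ∂μ - ∫ x in spanningSets μ n, g x ∂μ := by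
    intro n
    set S := spanningSets μ n
    have hS : MeasurableSet S := measurableSet_spanningSets μ n
    have hC : MeasurableSet (S \ B) := hS.diff hB
    have hμC : μ (S \ B) < ∞ := (measure_mono Set.sdiff_subset).trans_lt
      (measure_spanningSets_lt_top μ n)
    have hU : MeasurableSet (B ∪ S \ B) := hB.union hC
    have hμU : μ (B ∪ S \ B) < ∞ := measure_union_lt_top hμB hμC
    have h1 : ∫ x, g x * φ (B ∪ S \ B) x ∂μ =
        ∫ x, g x * φ B x ∂μ + ∫ x, g x * φ (S \ B) x ∂μ := by
      rw [← integral_add (hφ.integrable_mul hg hB hμB) (hφ.integrable_mul hg hC hμC)]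
      refine integral_congr_ae ?_
      filter_upwards [hφ.add B (S \ B) hB hC hμB hμC Set.disjoint_sdiff_right] with x hx
      rw [hx, mul_add]
    have h2 : ∫ x in B ∪ S \ B, g x ∂μ = ∫ x in B, g x ∂μ + ∫ x in S \ B, g x ∂μ :=
      setIntegral_union Set.disjoint_sdiff_right hC hg.integrableOn hg.integrableOn
    have h3 : ∫ x, g x * φ (B ∪ S \ B) x ∂μ ≤ ∫ x, g x ∂μ :=
      integral_mono (hφ.integrable_mul hg hU hμU) hg fun x =>
        mul_le_of_le_one_right (hg0 x) (hφ.le_one _ hU hμU x)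
    have h4 : ∫ x in S, g x ∂μ ≤ ∫ x in B ∪ S \ B, g x ∂μ := by
      refine setIntegral_mono_set hg.integrableOn (Eventually.of_forall hg0)
        (Eventually.of_forall fun x hx => ?_)
      by_cases hxB : x ∈ B
      · exact Or.inl hxB
      · exact Or.inr ⟨hx, hxB⟩
    linarith [hle _ hC hμC]
  have hlim : Tendsto (fun n => ∫ x, g x ∂μ - ∫ x in spanningSets μ n, g x ∂μ) atTop (𝓝 0) := by
    have := tendsto_setIntegral_of_monotone (measurableSet_spanningSets μ)
      (monotone_spanningSets μ) (f := g) (μ := μ) hg.integrableOn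
    rw [iUnion_spanningSets, setIntegral_univ] at this
    simpa using (tendsto_const_nhds (x := ∫ x, g x ∂μ)).sub this
  linarith [ge_of_tendsto' hlim hkey]

/-- Since `Φ 1 ≤ 1` (this is `integral_le`), `f - 1 ≤ Φ (f - 1) ≤ Φ (f - 1)⁺`, so `(f - 1)⁺` lies
below its image, and `IsSubMarkov.isFixed_of_le` turns this into equality. The set `C` is where the
positive part is active. -/
theorem IsFixed.sub_one_max_zero [SigmaFinite μ] (hφ : IsSubMarkov μ φ) {f : X → ℝ}
    (hf : IsFixed μ φ f) (hf0 : ∀ x, 0 ≤ f x) : IsFixed μ φ fun x => max (f x - 1) 0 := by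
  have hm : Measurable fun x => max (f x - 1) 0 := (hf.measurable.sub_const 1).max measurable_const
  have hle : ∀ x, max (f x - 1) 0 ≤ f x := fun x => max_le (by linarith) (hf0 x)
  have hint : Integrable (fun x => max (f x - 1) 0) μ := by
    refine hf.integrable.mono' hm.aestronglyMeasurable (Eventually.of_forall fun x => ?_)
    rw [Real.norm_of_nonneg (le_max_right _ _)]
    exact hle x
  refine hφ.isFixed_of_le hm hint (fun x => le_max_right _ _) fun B hB hμB => ?_
  set C := B ∩ {x | 1 < f x} with hCdef
  have hC : MeasurableSet C := hB.inter (measurableSet_lt measurable_const hf.measurable)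
  have hCB : C ⊆ B := Set.inter_subset_left
  have hμC : μ C < ∞ := (measure_mono hCB).trans_lt hμB
  calc ∫ x in B, max (f x - 1) 0 ∂μ = ∫ x in C, max (f x - 1) 0 ∂μ := by
        refine setIntegral_eq_of_subset_of_forall_sdiff_eq_zero hB hCB fun x hx => ?_
        have : ¬ 1 < f x := fun h => hx.2 ⟨hx.1, h⟩
        exact max_eq_right (by linarith)
    _ = ∫ x in C, (f x - 1) ∂μ := by
        refine setIntegral_congr_fun hC fun x hx => ?_
        have : 1 < f x := hx.2
        exact max_eq_left (by linarith)
    _ = ∫ x, f x * φ C x ∂μ - μ.real C := by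
        rw [integral_sub hf.integrable.integrableOn (integrableOn_const hμC.ne),
          hf.eq C hC hμC]
        simp
    _ ≤ ∫ x, f x * φ C x ∂μ - ∫ x, φ C x ∂μ := by linarith [hφ.integral_le C hC hμC]
    _ = ∫ x, (f x * φ C x - φ C x) ∂μ :=
        (integral_sub (hφ.integrable_mul hf.integrable hC hμC) (hφ.integrable C hC hμC)).symm
    _ ≤ ∫ x, max (f x - 1) 0 * φ B x ∂μ := by
        refine integral_mono_ae ((hφ.integrable_mul hf.integrable hC hμC).sub
          (hφ.integrable C hC hμC)) (hφ.integrable_mul hint hB hμB) ?_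
        filter_upwards [hφ.mono hC hB hμB hCB] with x hx
        have h0 := hφ.nonneg C hC hμC x
        calc f x * φ C x - φ C x = (f x - 1) * φ C x := by ring
          _ ≤ max (f x - 1) 0 * φ C x := by gcongr; exact le_max_left _ _
          _ ≤ max (f x - 1) 0 * φ B x := by gcongr

theorem IsFixed.sub_const_max_zero [SigmaFinite μ] (hφ : IsSubMarkov μ φ) {f : X → ℝ}
    (hf : IsFixed μ φ f) (hf0 : ∀ x, 0 ≤ f x) {c : ℝ} (hc : 0 < c) :
    IsFixed μ φ fun x => max (f x - c) 0 := by
  have h := ((hf.const_mul c⁻¹).sub_one_max_zero hφ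
    fun x => mul_nonneg (by positivity) (hf0 x)).const_mul c
  refine h.congr (by have := hf.measurable; fun_prop) (Eventually.of_forall fun x => ?_)
  simp only
  rw [mul_max_of_nonneg _ _ hc.le, mul_zero]
  congr 1
  field_simp

/-- The level sets of a nonnegative fixed function are fixed. -/
theorem IsFixed.indicator_lt [SigmaFinite μ] (hφ : IsSubMarkov μ φ) {f : X → ℝ}
    (hf : IsFixed μ φ f) (hf0 : ∀ x, 0 ≤ f x) {c : ℝ} (hc : 0 < c) :
    IsFixed μ φ ({x | c < f x}.indicator fun _ => 1) := by
  let h : ℕ → X → ℝ := fun n x => n * max (f x - c) 0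
  have hh0 : ∀ n x, 0 ≤ h n x := fun n x => mul_nonneg n.cast_nonneg (le_max_right _ _)
  have hh : ∀ n, IsFixed μ φ (h n) := fun n => (hf.sub_const_max_zero hφ hf0 hc).const_mul n
  -- `h - (h - 1)⁺ = min h 1` is built from fixed functions and tends to the indicator of `c < f`;
  -- by Markov's bound it stays below `f / c`.
  refine IsFixed.of_tendsto hφ (f := fun n x => h n x - max (h n x - 1) 0)
    (fun n => (hh n).sub hφ ((hh n).sub_one_max_zero hφ (hh0 n)))
    (hf.integrable.const_mul c⁻¹) (fun n x => ?_) fun x => ?_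
  · by_cases hx : c < f x
    · have h1 : |h n x - max (h n x - 1) 0| ≤ 1 := by
        rw [abs_le]
        constructor
        · rcases max_cases (h n x - 1) 0 with h | h <;> linarith [hh0 n x]
        · linarith [le_max_left (h n x - 1) 0]
      refine h1.trans ?_
      rw [inv_mul_eq_div, le_div_iff₀ hc]
      linarith
    · have h1 : h n x = 0 := by
        simp only [h]
        rw [max_eq_right (by linarith), mul_zero]
      rw [h1]
      simpa using mul_nonneg (inv_nonneg.mpr hc.le) (hf0 x)
  · by_cases hx : c < f x
    · rw [Set.indicator_of_mem (show x ∈ {x | c < f x} from hx)]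
      refine tendsto_const_nhds.congr' ?_
      have hlim : Tendsto (fun n => h n x) atTop atTop := by
        refine tendsto_natCast_atTop_atTop.atTop_mul_const ?_
        exact lt_max_of_lt_left (by linarith)
      filter_upwards [hlim.eventually_ge_atTop 1] with n hn
      rw [max_eq_left (by linarith)]
      ring
    · rw [Set.indicator_of_notMem (show x ∉ {x | c < f x} from hx)]
      refine tendsto_const_nhds.congr fun n => ?_
      have h1 : h n x = 0 := by
        simp only [h]
        rw [max_eq_right (by linarith), mul_zero]
      simp [h1]

/-- The sets whose indicator is fixed. -/
def IsFixedSet (μ : Measure X) (φ : Set X → X → ℝ) (A : Set X) : Prop :=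
  MeasurableSet A ∧ IsFixed μ φ (A.indicator fun _ => 1)

theorem IsFixedSet.lt_top {A : Set X} (hA : IsFixedSet μ φ A) : μ A < ∞ := by
  have := hA.2.integrable
  rw [integrable_indicator_iff hA.1, integrableOn_const_iff] at this
  simpa using this

theorem IsFixed.isFixedSet_lt [SigmaFinite μ] (hφ : IsSubMarkov μ φ) {f : X → ℝ}
    (hf : IsFixed μ φ f) (hf0 : ∀ x, 0 ≤ f x) {c : ℝ} (hc : 0 < c) :
    IsFixedSet μ φ {x | c < f x} :=
  ⟨measurableSet_lt measurable_const hf.measurable, hf.indicator_lt hφ hf0 hc⟩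

/-- The superlevel sets of the fixed function `1_A + 1_B` at `1 / 2` and `3 / 2` are the union and
the intersection. -/
theorem IsFixedSet.union [SigmaFinite μ] (hφ : IsSubMarkov μ φ) {A B : Set X}
    (hA : IsFixedSet μ φ A) (hB : IsFixedSet μ φ B) : IsFixedSet μ φ (A ∪ B) := by
  have h := (hA.2.add hφ hB.2).isFixedSet_lt hφ (c := 1 / 2)
    (fun x => add_nonneg (Set.indicator_nonneg (by simp) x) (Set.indicator_nonneg (by simp) x))
    (by norm_num)
  convert h using 1
  ext x
  by_cases hxA : x ∈ A <;> by_cases hxB : x ∈ B <;> simp [hxA, hxB] <;> norm_num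

theorem IsFixedSet.inter [SigmaFinite μ] (hφ : IsSubMarkov μ φ) {A B : Set X}
    (hA : IsFixedSet μ φ A) (hB : IsFixedSet μ φ B) : IsFixedSet μ φ (A ∩ B) := by
  have h := (hA.2.add hφ hB.2).isFixedSet_lt hφ (c := 3 / 2)
    (fun x => add_nonneg (Set.indicator_nonneg (by simp) x) (Set.indicator_nonneg (by simp) x))
    (by norm_num)
  convert h using 1
  ext x
  by_cases hxA : x ∈ A <;> by_cases hxB : x ∈ B <;> simp [hxA, hxB] <;> norm_num

theorem IsFixedSet.diff [SigmaFinite μ] (hφ : IsSubMarkov μ φ) {A B : Set X}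
    (hA : IsFixedSet μ φ A) (hB : IsFixedSet μ φ B) : IsFixedSet μ φ (A \ B) := by
  refine ⟨hA.1.diff hB.1, (hA.2.sub hφ (hA.inter hφ hB).2).congr
    (measurable_const.indicator (hA.1.diff hB.1)) (Eventually.of_forall fun x => ?_)⟩
  by_cases hxA : x ∈ A <;> by_cases hxB : x ∈ B <;> simp [hxA, hxB]

theorem isFixedSet_empty : IsFixedSet μ φ ∅ :=
  ⟨MeasurableSet.empty, by simp, by simp, by simp⟩

theorem IsFixedSet.iUnion [SigmaFinite μ] (hφ : IsSubMarkov μ φ) {A : ℕ → Set X}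
    (hA : ∀ n, IsFixedSet μ φ (A n)) (hμ : μ (⋃ n, A n) < ∞) : IsFixedSet μ φ (⋃ n, A n) := by
  have hU : MeasurableSet (⋃ n, A n) := MeasurableSet.iUnion fun n => (hA n).1
  have hacc : ∀ n, IsFixedSet μ φ (Set.accumulate A n) := by
    intro n
    induction n with
    | zero => simpa [Set.accumulate_zero_nat] using hA 0
    | succ n ih =>
      rw [Set.accumulate_succ]
      exact ih.union hφ (hA _)
  have hsub : ∀ n, Set.accumulate A n ⊆ ⋃ n, A n := fun n => Set.accumulate_subset_iUnion n
  refine ⟨hU, IsFixed.of_tendsto hφ (fun n => (hacc n).2)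
    (b := (⋃ n, A n).indicator fun _ => 1) ?_ (fun n x => ?_) fun x => ?_⟩
  · exact (integrable_indicator_iff hU).mpr (integrableOn_const hμ.ne)
  · rw [abs_of_nonneg (Set.indicator_nonneg (by simp) x)]
    exact Set.indicator_le_indicator_of_subset (hsub n) (fun _ => zero_le_one) x
  · have := Set.monotone_accumulate.tendsto_indicator (Set.accumulate A)
      (fun _ : X => (1 : ℝ)) x
    rw [Set.iUnion_accumulate] at this
    exact this.mono_right (pure_le_nhds _)

end Fixed

/-! ### Multiplicative functionals of a Poisson configuration. -/

section Avoid

variable {X : Type*} [MeasurableSpace X]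

/-- The multiplicative functional `ν ↦ ∏ (1 - ψ x)`, the product being taken over the points `x`
of the configuration `ν`. -/
noncomputable def avoid (ψ : X → ℝ) (ν : Config X) : ℝ :=
  (expNeg (∫⁻ x, negLog (ENNReal.ofReal (1 - ψ x)) ∂ν.1)).toReal

theorem measurable_avoid {ψ : X → ℝ} (hψ : Measurable ψ) : Measurable (avoid ψ) := by
  refine (measurable_expNeg.comp (Config.measurable_lintegral ?_)).ennreal_toReal
  exact measurable_negLog.comp (by fun_prop)

theorem avoid_nonneg (ψ : X → ℝ) (ν : Config X) : 0 ≤ avoid ψ ν := ENNReal.toReal_nonneg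

theorem avoid_le_one (ψ : X → ℝ) (ν : Config X) : avoid ψ ν ≤ 1 := by
  rw [avoid, ← ENNReal.toReal_one]
  exact ENNReal.toReal_mono ENNReal.one_ne_top (expNeg_le_one _)

theorem norm_avoid_le_one (ψ : X → ℝ) (ν : Config X) : ‖avoid ψ ν‖ ≤ 1 := by
  rw [Real.norm_of_nonneg (avoid_nonneg ψ ν)]
  exact avoid_le_one ψ ν

theorem avoid_indicator_one {A : Set X} (hA : MeasurableSet A) :
    avoid (A.indicator fun _ => 1) = (void A).indicator fun _ => 1 := by
  funext ν
  have h : ∀ x, negLog (ENNReal.ofReal (1 - A.indicator (fun _ => (1 : ℝ)) x)) =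
      A.indicator (fun _ => ∞) x := by
    intro x
    by_cases hx : x ∈ A <;> simp [hx, negLog]
  simp_rw [avoid, h]
  rw [expNeg_lintegral_indicator_top hA]
  by_cases hν : ν ∈ void A <;> simp [hν]

/-- The constant `1 - exp (-1)` makes each point of `A` contribute the factor `exp (-1)`, so `avoid`
is `exp (-N_A)` and the count can be read off. -/
theorem avoid_indicator_const {A : Set X} (hA : MeasurableSet A) (ν : Config X) :
    negLog (ENNReal.ofReal (avoid (A.indicator fun _ => 1 - Real.exp (-1)) ν)) =
      Config.count A ν := by
  have h1 : negLog (ENNReal.ofReal (Real.exp (-1))) = 1 := by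
    rw [← negLog_expNeg 1, expNeg_of_ne_top ENNReal.one_ne_top]
    simp
  have h : ∀ x, negLog (ENNReal.ofReal (1 - A.indicator (fun _ => 1 - Real.exp (-1)) x)) =
      A.indicator 1 x := by
    intro x
    by_cases hx : x ∈ A
    · simp [hx, h1]
    · simp [hx, negLog]
  simp_rw [avoid, h]
  rw [lintegral_indicator_one hA, ENNReal.ofReal_toReal
    ((expNeg_le_one _).trans_lt ENNReal.one_lt_top).ne, negLog_expNeg]
  rfl

variable {μ : Measure X} {P : Measure (Config X)}

/-- The Laplace functional at `-log (1 - ψ) - log (1 - χ)`, with `1 - (1 - ψ) (1 - χ) = ψ + χ - ψ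
χ`. -/
theorem integral_avoid_mul_avoid [SigmaFinite μ] (hP : IsPoissonMeasure μ P) {ψ χ : X → ℝ}
    (hψ : Measurable ψ) (hψ0 : ∀ x, 0 ≤ ψ x) (hψ1 : ∀ x, ψ x ≤ 1) (hψi : Integrable ψ μ)
    (hχ : Measurable χ) (hχ0 : ∀ x, 0 ≤ χ x) (hχ1 : ∀ x, χ x ≤ 1) (hχi : Integrable χ μ) :
    ∫ ν, avoid ψ ν * avoid χ ν ∂P =
      Real.exp (-(∫ x, ψ x ∂μ + ∫ x, χ x ∂μ - ∫ x, ψ x * χ x ∂μ)) := by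
  have := hP.isProbabilityMeasure
  let a : X → ℝ≥0∞ := fun x => negLog (ENNReal.ofReal (1 - ψ x))
  let b : X → ℝ≥0∞ := fun x => negLog (ENNReal.ofReal (1 - χ x))
  have ha : Measurable a := measurable_negLog.comp (by fun_prop)
  have hb : Measurable b := measurable_negLog.comp (by fun_prop)
  have hmul : Integrable (fun x => ψ x * χ x) μ := hψi.mul_bdd (c := 1) hχ.aestronglyMeasurable
    (Eventually.of_forall fun x => by rw [Real.norm_of_nonneg (hχ0 x)]; exact hχ1 x)
  have h1 : ∀ ν, avoid ψ ν * avoid χ ν = (expNeg (∫⁻ x, (a x + b x) ∂ν.1)).toReal := by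
    intro ν
    rw [lintegral_add_left ha, expNeg_add, ENNReal.toReal_mul]
    rfl
  have h2 : ∀ x, 1 - expNeg (a x + b x) = ENNReal.ofReal (ψ x + χ x - ψ x * χ x) := by
    intro x
    have hle : ∀ y : ℝ, 0 ≤ y → ENNReal.ofReal (1 - y) ≤ 1 := fun y hy =>
      ENNReal.ofReal_le_one.mpr (by linarith)
    rw [expNeg_add, expNeg_negLog (hle _ (hψ0 x)), expNeg_negLog (hle _ (hχ0 x)),
      ← ENNReal.ofReal_mul (by linarith [hψ1 x]), ← ENNReal.ofReal_one,
      ← ENNReal.ofReal_sub _ (mul_nonneg (by linarith [hψ1 x]) (by linarith [hχ1 x]))]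
    congr 1
    ring
  have h0 : ∀ x, 0 ≤ ψ x + χ x - ψ x * χ x := fun x => by
    nlinarith [hψ0 x, hχ0 x, hψ1 x, hχ1 x]
  have hadd : Integrable (fun x => ψ x + χ x) μ := hψi.add hχi
  have hI : Integrable (fun x => ψ x + χ x - ψ x * χ x) μ := hadd.sub hmul
  have hIeq : ∫ x, (ψ x + χ x - ψ x * χ x) ∂μ =
      ∫ x, ψ x ∂μ + ∫ x, χ x ∂μ - ∫ x, ψ x * χ x ∂μ := by
    rw [integral_sub hadd hmul, integral_add hψi hχi]
  have hab : Measurable fun x => a x + b x := ha.add hb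
  have hE : Measurable fun ν : Config X => expNeg (∫⁻ x, (a x + b x) ∂ν.1) :=
    measurable_expNeg.comp (Config.measurable_lintegral hab)
  simp_rw [h1]
  rw [integral_toReal hE.aemeasurable
    (Eventually.of_forall fun ν => (expNeg_le_one _).trans_lt ENNReal.one_lt_top),
    hP.lintegral_expNeg hab]
  simp_rw [h2]
  rw [← ofReal_integral_eq_lintegral_ofReal hI (Eventually.of_forall h0),
    expNeg_toReal ENNReal.ofReal_ne_top, ENNReal.toReal_ofReal (integral_nonneg h0), hIeq]

theorem setIntegral_void_avoid [SigmaFinite μ] (hP : IsPoissonMeasure μ P) {ψ : X → ℝ}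
    (hψ : Measurable ψ) (hψ0 : ∀ x, 0 ≤ ψ x) (hψ1 : ∀ x, ψ x ≤ 1) (hψi : Integrable ψ μ)
    {B : Set X} (hB : MeasurableSet B) (hμB : μ B < ∞) :
    ∫ ν in void B, avoid ψ ν ∂P =
      Real.exp (-(∫ x, ψ x ∂μ + μ.real B - ∫ x in B, ψ x ∂μ)) := by
  have h := integral_avoid_mul_avoid hP hψ hψ0 hψ1 hψi (χ := B.indicator fun _ => 1)
    (measurable_const.indicator hB) (fun x => Set.indicator_nonneg (by simp) x)
    (fun x => Set.indicator_le' (fun _ _ => le_rfl) (fun _ _ => zero_le_one) x)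
    ((integrable_indicator_iff hB).mpr (integrableOn_const hμB.ne))
  have h1 : ∀ x, ψ x * B.indicator (fun _ => (1 : ℝ)) x = B.indicator ψ x := by
    intro x
    by_cases hx : x ∈ B <;> simp [hx]
  have h2 : ∀ ν, avoid ψ ν * (void B).indicator (fun _ => (1 : ℝ)) ν =
      (void B).indicator (avoid ψ) ν := by
    intro x
    by_cases hx : x ∈ void B <;> simp [hx]
  rw [avoid_indicator_one hB] at h
  simp_rw [h1, h2] at h
  rw [integral_indicator (measurableSet_void hB), integral_indicator hB,
    integral_indicator hB] at h
  simpa using h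

/-- `φ A` is the density of `m A ·`. Symmetry of `m` moves domination and additivity to the other
variable, which gives integrability, the bound on the integral, and additivity of `φ` in `A`. -/
theorem IsPairing.exists_isSubMarkov [SigmaFinite μ] {m : Set X → Set X → ℝ}
    (hm : IsPairing μ m) : ∃ φ, IsSubMarkov μ φ ∧
      ∀ A B, MeasurableSet A → MeasurableSet B → μ A < ∞ → μ B < ∞ → m A B = ∫ x in B, φ A x ∂μ := by
  have hex : ∀ A, MeasurableSet A ∧ μ A < ∞ → ∃ φ : X → ℝ, Measurable φ ∧ (∀ x, 0 ≤ φ x) ∧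
      (∀ x, φ x ≤ 1) ∧ ∀ B, MeasurableSet B → μ B < ∞ → m A B = ∫ x in B, φ x ∂μ :=
    fun A ⟨hA, hμA⟩ => exists_density (fun B hB hμB => hm.nonneg A B hA hB hμA hμB)
      (fun B hB hμB => hm.le A B hA hB hμA hμB)
      (fun B C hB hC hμB hμC hBC => hm.add A B C hA hB hC hμA hμB hμC hBC)
  choose! φ hφm hφ0 hφ1 hφ using hex
  have hset : ∀ A B, MeasurableSet A → MeasurableSet B → μ A < ∞ → μ B < ∞ →
      ∫⁻ x in B, ‖φ A x‖ₑ ∂μ ≤ μ A := by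
    intro A B hA hB hμA hμB
    have hint : IntegrableOn (φ A) B μ := by
      refine Integrable.mono' (g := fun _ => (1 : ℝ)) (integrableOn_const hμB.ne)
        (hφm A ⟨hA, hμA⟩).aestronglyMeasurable (Eventually.of_forall fun x => ?_)
      rw [Real.norm_of_nonneg (hφ0 A ⟨hA, hμA⟩ x)]
      exact hφ1 A ⟨hA, hμA⟩ x
    have h1 : ∀ x, ‖φ A x‖ₑ = ENNReal.ofReal (φ A x) := fun x =>
      Real.enorm_of_nonneg (hφ0 A ⟨hA, hμA⟩ x)
    simp_rw [h1]
    rw [← ofReal_integral_eq_lintegral_ofReal hint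
      (Eventually.of_forall (hφ0 A ⟨hA, hμA⟩)), ← hφ A ⟨hA, hμA⟩ B hB hμB, hm.symm A B hA hB]
    exact ENNReal.ofReal_le_of_le_toReal (hm.le B A hB hA hμB hμA)
  have hint : ∀ A, MeasurableSet A → μ A < ∞ → Integrable (φ A) μ := fun A hA hμA =>
    integrable_of_forall_fin_meas_le (μ A) hμA (hφm A ⟨hA, hμA⟩).aestronglyMeasurable
      fun B hB hμB => hset A B hA hB hμA hμB.lt_top
  refine ⟨φ, ⟨fun A hA hμA => hφm A ⟨hA, hμA⟩, fun A hA hμA => hφ0 A ⟨hA, hμA⟩,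
    fun A hA hμA => hφ1 A ⟨hA, hμA⟩, hint, fun A hA hμA => ?_,
    fun A B hA hB hμA hμB hAB => ?_⟩, fun A B hA hB hμA hμB => hφ A ⟨hA, hμA⟩ B hB hμB⟩
  · have hlim := tendsto_setIntegral_of_monotone (measurableSet_spanningSets μ)
      (monotone_spanningSets μ) (f := φ A) (μ := μ) (hint A hA hμA).integrableOn
    rw [iUnion_spanningSets, setIntegral_univ] at hlim
    refine le_of_tendsto' hlim fun n => ?_
    have hS := measurableSet_spanningSets μ n
    have hμS := measure_spanningSets_lt_top μ n
    rw [← hφ A ⟨hA, hμA⟩ _ hS hμS, hm.symm A _ hA hS]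
    exact hm.le _ A hS hA hμS hμA
  · have hU := hA.union hB
    have hμU := measure_union_lt_top hμA hμB
    refine Integrable.ae_eq_of_forall_setIntegral_eq _ _ (hint _ hU hμU)
      ((hint A hA hμA).add (hint B hB hμB)) fun C hC hμC => ?_
    rw [integral_add (hint A hA hμA).integrableOn (hint B hB hμB).integrableOn,
      ← hφ _ ⟨hU, hμU⟩ C hC hμC, ← hφ A ⟨hA, hμA⟩ C hC hμC, ← hφ B ⟨hB, hμB⟩ C hC hμC,
      hm.symm _ C hU hC, hm.symm A C hA hC, hm.symm B C hB hC,
      hm.add C A B hC hA hB hμC hμA hμB hAB]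

end Avoid

/-! ### Conditional expectation as a self-adjoint projection. -/

section CondExp

theorem integral_condExp_mul_condExp {Ω : Type*} {F m0 : MeasurableSpace Ω} {P : Measure Ω}
    [IsFiniteMeasure P] (hF : F ≤ m0) {f g : Ω → ℝ}
    (hgm : AEStronglyMeasurable g P) {c : ℝ} (hgc : ∀ ω, ‖g ω‖ ≤ c) :
    ∫ ω, (P[f|F]) ω * (P[g|F]) ω ∂P = ∫ ω, (P[f|F]) ω * g ω ∂P := by
  have hg : Integrable g P := Integrable.of_bound hgm c (Eventually.of_forall hgc)
  have hmul : Integrable (P[f|F] * g) P :=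
    integrable_condExp.mul_bdd (c := c) hgm (Eventually.of_forall hgc)
  have h := condExp_mul_of_stronglyMeasurable_left (m := F) stronglyMeasurable_condExp hmul hg
  calc ∫ ω, (P[f|F]) ω * (P[g|F]) ω ∂P = ∫ ω, (P[P[f|F] * g|F]) ω ∂P :=
        (integral_congr_ae h).symm
    _ = ∫ ω, (P[f|F]) ω * g ω ∂P := integral_condExp hF

theorem integral_condExp_mul_comm {Ω : Type*} {F m0 : MeasurableSpace Ω} {P : Measure Ω}
    [IsFiniteMeasure P] (hF : F ≤ m0) {f g : Ω → ℝ} (hfm : AEStronglyMeasurable f P)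
    (hgm : AEStronglyMeasurable g P) {c : ℝ} (hfc : ∀ ω, ‖f ω‖ ≤ c) (hgc : ∀ ω, ‖g ω‖ ≤ c) :
    ∫ ω, (P[f|F]) ω * g ω ∂P = ∫ ω, f ω * (P[g|F]) ω ∂P := by
  rw [← integral_condExp_mul_condExp hF hgm hgc]
  simp only [mul_comm ((P[f|F]) _), mul_comm (f _)]
  rw [integral_condExp_mul_condExp hF hfm hfc]

end CondExp

/-! ### The sub-Markov operator of a factor. -/

section Kernel

variable {X : Type*} [MeasurableSpace X]

/-- The sub-Markov operator `φ` describes the conditional expectations of the void events. -/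
structure IsVoidKernel (μ : Measure X) (P : Measure (Config X)) (F : MeasurableSpace (Config X))
    (φ : Set X → X → ℝ) : Prop where
  subMarkov : IsSubMarkov μ φ
  symm : ∀ A B, MeasurableSet A → MeasurableSet B → μ A < ∞ → μ B < ∞ →
    ∫ x in B, φ A x ∂μ = ∫ x in A, φ B x ∂μ
  setIntegral_condExp : ∀ A B, MeasurableSet A → MeasurableSet B → μ A < ∞ → μ B < ∞ →
    ∫ ν in void B, (P[(void A).indicator fun _ => (1 : ℝ)|F]) ν ∂P =
      Real.exp (-μ.real A - μ.real B + ∫ x in B, φ A x ∂μ)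

theorem norm_indicator_one_le {Ω : Type*} (s : Set Ω) (ω : Ω) :
    ‖s.indicator (fun _ => (1 : ℝ)) ω‖ ≤ 1 := by
  by_cases h : ω ∈ s <;> simp [h]

theorem indicator_one_ae_eq {Ω : Type*} {m0 : MeasurableSpace Ω} {P : Measure Ω} {s t : Set Ω}
    (h : s =ᵐ[P] t) : s.indicator (fun _ => (1 : ℝ)) =ᵐ[P] t.indicator fun _ => 1 :=
  indicator_ae_eq_of_ae_eq_set h

theorem mul_indicator_one {Ω : Type*} (f : Ω → ℝ) (s : Set Ω) (ω : Ω) :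
    f ω * s.indicator (fun _ => (1 : ℝ)) ω = s.indicator f ω := by
  by_cases h : ω ∈ s <;> simp [h]

theorem IsRelIndepSelfJoining.measureReal_prod {Ω : Type*} {m0 : MeasurableSpace Ω}
    {P : Measure Ω} [IsFiniteMeasure P] {J : Measure (Ω × Ω)} {F : MeasurableSpace Ω} (hF : F ≤ m0)
    (hJ : IsRelIndepSelfJoining F P J) {A B : Set Ω} (hA : MeasurableSet[m0] A)
    (hB : MeasurableSet[m0] B) :
    J.real (A ×ˢ B) = ∫ ω in B, (P[A.indicator fun _ => (1 : ℝ)|F]) ω ∂P := by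
  have h0 : ∀ s : Set Ω, 0 ≤ᵐ[P] P[s.indicator fun _ => (1 : ℝ)|F] := fun s =>
    condExp_nonneg (Eventually.of_forall fun ω => Set.indicator_nonneg (fun _ _ => zero_le_one) ω)
  rw [measureReal_def, hJ A B hA hB, ENNReal.toReal_ofReal, integral_condExp_mul_condExp hF
    (aestronglyMeasurable_const.indicator hB) (norm_indicator_one_le B)]
  · simp_rw [mul_indicator_one]
    rw [integral_indicator hB]
  · refine integral_nonneg_of_ae ?_
    filter_upwards [h0 A, h0 B] with ω h1 h2 using mul_nonneg h1 h2

theorem IsRelIndepSelfJoining.measureReal_prod_comm {Ω : Type*} {m0 : MeasurableSpace Ω}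
    {P : Measure Ω} {J : Measure (Ω × Ω)} {F : MeasurableSpace Ω}
    (hJ : IsRelIndepSelfJoining F P J) {A B : Set Ω} (hA : MeasurableSet[m0] A)
    (hB : MeasurableSet[m0] B) : J.real (A ×ˢ B) = J.real (B ×ˢ A) := by
  rw [measureReal_def, measureReal_def, hJ A B hA hB, hJ B A hB hA]
  simp_rw [mul_comm]

variable {μ : Measure X} {P : Measure (Config X)}

theorem exists_isVoidKernel [SigmaFinite μ] (hP : IsPoissonMeasure μ P)
    {J : Measure (Config X × Config X)} (hJ_div : IsInfinitelyDivisible J)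
    {F : MeasurableSpace (Config X)} (hF : F ≤ Config.instMeasurableSpace)
    (hJ : IsRelIndepSelfJoining F P J) : ∃ φ, IsVoidKernel μ P F φ := by
  have := hP.isProbabilityMeasure
  have hmarg : ∀ A, MeasurableSet A → μ A < ∞ →
      J.real (void A ×ˢ void ∅) = Real.exp (-μ.real A) := by
    intro A hA hμA
    rw [hJ.measureReal_prod hF (measurableSet_void hA) (measurableSet_void MeasurableSet.empty),
      void_empty, setIntegral_univ, integral_condExp hF, integral_indicator (measurableSet_void hA),
      ← hP.measureReal_void hA hμA]
    simp
  obtain ⟨hm, hpos⟩ := isPairing_voidPairing hJ_div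
    (fun A B hA hB => hJ.measureReal_prod_comm (measurableSet_void hA) (measurableSet_void hB)) hmarg
  obtain ⟨φ, hφ, hmφ⟩ := hm.exists_isSubMarkov
  refine ⟨φ, hφ, fun A B hA hB hμA hμB => ?_, fun A B hA hB hμA hμB => ?_⟩
  · rw [← hmφ A B hA hB hμA hμB, ← hmφ B A hB hA hμB hμA, hm.symm A B hA hB]
  · rw [← hJ.measureReal_prod hF (measurableSet_void hA) (measurableSet_void hB),
      ← hmφ A B hA hB hμA hμB, voidPairing, ← Real.exp_log (hpos A B hA hB hμA hμB)]
    simp only [Real.log_exp]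
    congr 1
    ring

variable {F : MeasurableSpace (Config X)} {φ : Set X → X → ℝ}

/-- Symmetry of the kernel turns the weak fixed-point equation for `1_A` into `φ A = 1_A`, in
integrated form. -/
theorem IsVoidKernel.isFixedSet_iff (hφ : IsVoidKernel μ P F φ) {A : Set X}
    (hA : MeasurableSet A) (hμA : μ A < ∞) :
    IsFixedSet μ φ A ↔ ∀ B, MeasurableSet B → μ B < ∞ → ∫ x in B, φ A x ∂μ = μ.real (A ∩ B) := by
  have h1 : ∀ B, MeasurableSet B → μ B < ∞ →
      ∫ x, A.indicator (fun _ => (1 : ℝ)) x * φ B x ∂μ = ∫ x in B, φ A x ∂μ := by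
    intro B hB hμB
    simp_rw [mul_comm (A.indicator _ _), mul_indicator_one]
    rw [integral_indicator hA, hφ.symm A B hA hB hμA hμB]
  have h2 : ∀ B, MeasurableSet B → ∫ x in B, A.indicator (fun _ => (1 : ℝ)) x ∂μ =
      μ.real (A ∩ B) := by
    intro B hB
    rw [integral_indicator hA, Measure.restrict_restrict hA]
    simp
  constructor
  · intro h B hB hμB
    rw [← h1 B hB hμB, ← h.2.eq B hB hμB, h2 B hB]
  · refine fun h => ⟨hA, measurable_const.indicator hA,
      (integrable_indicator_iff hA).mpr (integrableOn_const hμA.ne), fun B hB hμB => ?_⟩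
    rw [h1 B hB hμB, h2 B hB, h B hB hμB]

variable [StandardBorelSpace X] [SigmaFinite μ] [NullSingletonClass μ]

/-- Both sides have the same integrals over void events. The version `ψ` of `φ A` is left free so
that one vanishing off `K` can be used later. -/
theorem IsVoidKernel.condExp_void (hP : IsPoissonMeasure μ P) (hφ : IsVoidKernel μ P F φ)
    {A : Set X} (hA : MeasurableSet A) (hμA : μ A < ∞) {ψ : X → ℝ} (hψ : Measurable ψ)
    (hψ0 : ∀ x, 0 ≤ ψ x) (hψ1 : ∀ x, ψ x ≤ 1) (hψφ : ψ =ᵐ[μ] φ A) :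
    P[(void A).indicator fun _ => (1 : ℝ)|F] =ᵐ[P]
      fun ν => Real.exp (-μ.real A + ∫ x, φ A x ∂μ) * avoid ψ ν := by
  have := hP.isProbabilityMeasure
  have hψi : Integrable ψ μ := (hφ.subMarkov.integrable A hA hμA).congr hψφ.symm
  have hint : Integrable (avoid ψ) P := Integrable.of_bound
    (measurable_avoid hψ).aestronglyMeasurable 1 (Eventually.of_forall (norm_avoid_le_one ψ))
  refine hP.ae_eq_of_setIntegral_void integrable_condExp (hint.const_mul _) fun B hB hμB => ?_
  rw [hφ.setIntegral_condExp A B hA hB hμA hμB, integral_const_mul,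
    setIntegral_void_avoid hP hψ hψ0 hψ1 hψi hB hμB, ← Real.exp_add, integral_congr_ae hψφ,
    integral_congr_ae (ae_restrict_of_ae hψφ)]
  congr 1
  ring

/-- This is idempotence of conditional expectation: the integral of `E[1_{void A} | F] E[1_{void B}
| F]` equals that of `E[1_{void A} | F]` over `void B`, and comparing exponents gives `∫ φ A φ B =
∫_B φ A`. -/
theorem IsVoidKernel.isFixed (hP : IsPoissonMeasure μ P) (hF : F ≤ Config.instMeasurableSpace)
    (hφ : IsVoidKernel μ P F φ) {A : Set X} (hA : MeasurableSet A) (hμA : μ A < ∞) :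
    IsFixed μ φ (φ A) := by
  have := hP.isProbabilityMeasure
  have hs := hφ.subMarkov
  refine ⟨hs.measurable A hA hμA, hs.integrable A hA hμA, fun B hB hμB => ?_⟩
  have hAe := hφ.condExp_void hP hA hμA (hs.measurable A hA hμA) (hs.nonneg A hA hμA)
    (hs.le_one A hA hμA) (ae_eq_refl _)
  have hBe := hφ.condExp_void hP hB hμB (hs.measurable B hB hμB) (hs.nonneg B hB hμB)
    (hs.le_one B hB hμB) (ae_eq_refl _)
  have h1 := integral_condExp_mul_condExp hF (P := P) (f := (void A).indicator fun _ => (1 : ℝ))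
    (aestronglyMeasurable_const.indicator (measurableSet_void hB))
    (norm_indicator_one_le (void B))
  simp_rw [mul_indicator_one] at h1
  rw [integral_indicator (measurableSet_void hB),
    hφ.setIntegral_condExp A B hA hB hμA hμB] at h1
  have h2 : ∫ ν, (P[(void A).indicator fun _ => (1 : ℝ)|F]) ν *
      (P[(void B).indicator fun _ => (1 : ℝ)|F]) ν ∂P =
      ∫ ν, Real.exp (-μ.real A + ∫ x, φ A x ∂μ) * Real.exp (-μ.real B + ∫ x, φ B x ∂μ) *
        (avoid (φ A) ν * avoid (φ B) ν) ∂P := by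
    refine integral_congr_ae ?_
    filter_upwards [hAe, hBe] with ν h h'
    rw [h, h']
    ring
  rw [h2, integral_const_mul, integral_avoid_mul_avoid hP (hs.measurable A hA hμA)
    (hs.nonneg A hA hμA) (hs.le_one A hA hμA) (hs.integrable A hA hμA) (hs.measurable B hB hμB)
    (hs.nonneg B hB hμB) (hs.le_one B hB hμB) (hs.integrable B hB hμB), ← Real.exp_add,
    ← Real.exp_add, Real.exp_eq_exp] at h1
  linarith

/-- The number of points in a fixed set is measurable with respect to the factor. -/
theorem IsVoidKernel.measurable_count (hP : IsPoissonMeasure μ P)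
    (hF : F ≤ Config.instMeasurableSpace) (hφ : IsVoidKernel μ P F φ) {A : Set X}
    (hA : IsFixedSet μ φ A) : Measurable[nullCompletion P F] (Config.count A) := by
  have := hP.isProbabilityMeasure
  have hs := hφ.subMarkov
  have hμA := hA.lt_top
  set s : ℝ := 1 - Real.exp (-1) with hsdef
  have hs0 : 0 ≤ s := by
    have := Real.exp_le_one_iff.mpr (show (-1 : ℝ) ≤ 0 by norm_num)
    linarith
  have hs1 : s ≤ 1 := by linarith [Real.exp_pos (-1)]
  set ψ : X → ℝ := A.indicator fun _ => s with hψdef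
  have hψ : Measurable ψ := measurable_const.indicator hA.1
  have hψ0 : ∀ x, 0 ≤ ψ x := fun x => Set.indicator_nonneg (fun _ _ => hs0) x
  have hψ1 : ∀ x, ψ x ≤ 1 := fun x =>
    Set.indicator_le' (fun _ _ => hs1) (fun _ _ => zero_le_one) x
  have hψi : Integrable ψ μ := (integrable_indicator_iff hA.1).mpr (integrableOn_const hμA.ne)
  have hg := (measurable_avoid hψ).aestronglyMeasurable (μ := P)
  have hint : Integrable (avoid ψ) P :=
    Integrable.of_bound hg 1 (Eventually.of_forall (norm_avoid_le_one ψ))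
  -- `exp (-N_A)` is its own conditional expectation: moving the conditioning onto `void B` replaces
  -- `∫_B ψ` by `∫ ψ φ B` in the exponent, and these agree because `A` is fixed.
  have key : P[avoid ψ|F] =ᵐ[P] avoid ψ := by
    refine hP.ae_eq_of_setIntegral_void integrable_condExp hint fun B hB hμB => ?_
    have hB1 := hφ.condExp_void hP hB hμB (hs.measurable B hB hμB) (hs.nonneg B hB hμB)
      (hs.le_one B hB hμB) (ae_eq_refl _)
    have h1 := integral_condExp_mul_comm hF hg
      (aestronglyMeasurable_const.indicator (measurableSet_void hB))
      (norm_avoid_le_one ψ) (norm_indicator_one_le (void B))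
    simp_rw [mul_indicator_one] at h1
    rw [integral_indicator (measurableSet_void hB)] at h1
    have h2 : ∫ ν, avoid ψ ν * (P[(void B).indicator fun _ => (1 : ℝ)|F]) ν ∂P =
        ∫ ν, Real.exp (-μ.real B + ∫ x, φ B x ∂μ) * (avoid ψ ν * avoid (φ B) ν) ∂P := by
      refine integral_congr_ae ?_
      filter_upwards [hB1] with ν h
      rw [h]
      ring
    have h3 : ∫ x, ψ x * φ B x ∂μ = s * μ.real (A ∩ B) := by
      rw [← (hφ.isFixedSet_iff hA.1 hμA).mp hA B hB hμB, hφ.symm A B hA.1 hB hμA hμB,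
        ← integral_const_mul, ← integral_indicator hA.1]
      refine integral_congr_ae (Eventually.of_forall fun x => ?_)
      by_cases hx : x ∈ A <;> simp [hψdef, hx]
    have h4 : ∫ x in B, ψ x ∂μ = s * μ.real (A ∩ B) := by
      rw [hψdef, integral_indicator hA.1, Measure.restrict_restrict hA.1]
      simp [mul_comm]
    rw [h1, h2, integral_const_mul, integral_avoid_mul_avoid hP hψ hψ0 hψ1 hψi
      (hs.measurable B hB hμB) (hs.nonneg B hB hμB) (hs.le_one B hB hμB)
      (hs.integrable B hB hμB), setIntegral_void_avoid hP hψ hψ0 hψ1 hψi hB hμB, h3, h4,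
      ← Real.exp_add]
    congr 1
    ring
  have h5 : Measurable[nullCompletion P F] (avoid ψ) :=
    Measurable.eventuallyMeasurable_of_eventuallyEq
      (stronglyMeasurable_condExp (m := F)).measurable key.symm
  have h6 : Config.count A = (fun t : ℝ => negLog (ENNReal.ofReal t)) ∘ avoid ψ :=
    funext fun ν => (avoid_indicator_const hA.1 ν).symm
  rw [h6]
  exact (measurable_negLog.comp ENNReal.measurable_ofReal).comp h5

/-- Describes fixed sets through `F` alone, which makes them visibly invariant. If `void A` is in
`F` mod `P`, then conditioning leaves it unchanged, and `P (void (A ∪ B)) = exp (-μ (A ∪ B))` forces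
`∫_B φ A = μ (A ∩ B)`. -/
theorem IsVoidKernel.isFixedSet_iff_void (hP : IsPoissonMeasure μ P)
    (hF : F ≤ Config.instMeasurableSpace) (hφ : IsVoidKernel μ P F φ) {A : Set X}
    (hA : MeasurableSet A) (hμA : μ A < ∞) :
    IsFixedSet μ φ A ↔ MeasurableSet[nullCompletion P F] (void A) := by
  have := hP.isProbabilityMeasure
  refine ⟨fun h => hφ.measurable_count hP hF h (measurableSet_singleton 0), ?_⟩
  rintro ⟨t, ht, hvt⟩
  have h1 : P[(void A).indicator fun _ => (1 : ℝ)|F] =ᵐ[P] (void A).indicator fun _ => (1 : ℝ) := by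
    have h2 : (void A).indicator (fun _ => (1 : ℝ)) =ᵐ[P] t.indicator fun _ => (1 : ℝ) :=
      indicator_one_ae_eq hvt
    refine (condExp_congr_ae h2).trans (EventuallyEq.trans ?_ h2.symm)
    have h3 : StronglyMeasurable[F] (t.indicator fun _ => (1 : ℝ)) :=
      stronglyMeasurable_const.indicator ht
    rw [condExp_of_stronglyMeasurable hF h3
      ((integrable_const (1 : ℝ)).indicator (hF t ht))]
  rw [hφ.isFixedSet_iff hA hμA]
  intro B hB hμB
  have h4 := hφ.setIntegral_condExp A B hA hB hμA hμB
  rw [integral_congr_ae (ae_restrict_of_ae h1), integral_indicator (measurableSet_void hA),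
    Measure.restrict_restrict (measurableSet_void hA), void_inter_void] at h4
  have h5 := hP.measureReal_void (hA.union hB) (measure_union_lt_top hμA hμB)
  simp only [integral_const, smul_eq_mul, mul_one, measureReal_restrict_apply_univ] at h4
  rw [h5, Real.exp_eq_exp] at h4
  have h6 := measureReal_union_add_inter (μ := μ) (s := A) hB hμA.ne hμB.ne
  linarith

end Kernel

/-! ### Completions by null sets. -/

section Completion

variable {Ω : Type*} {m0 : MeasurableSpace Ω} {P : Measure Ω}

theorem nullCompletion_le {F F' : MeasurableSpace Ω} (h : F ≤ nullCompletion P F') :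
    nullCompletion P F ≤ nullCompletion P F' := by
  rintro s ⟨t, ht, hst⟩
  obtain ⟨t', ht', htt'⟩ := h t ht
  exact ⟨t', ht', hst.trans htt'⟩

theorem measurableSet_nullCompletion_of_ae_eq {F : MeasurableSpace Ω} {s : Set Ω} {r : Ω → ℝ}
    (hr : Measurable[F] r) (h : s.indicator (fun _ => (1 : ℝ)) =ᵐ[P] r) :
    MeasurableSet[nullCompletion P F] s := by
  refine ⟨r ⁻¹' {1}, hr (measurableSet_singleton 1), ?_⟩
  filter_upwards [h] with ω hω
  refine propext ?_
  change ω ∈ s ↔ r ω = 1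
  rw [← hω]
  by_cases hs : ω ∈ s <;> simp [hs]

theorem preimage_ae_eq_of_measurePreserving {T : Ω → Ω} (hT : MeasurePreserving T P P)
    {s t : Set Ω} (h : s =ᵐ[P] t) : T ⁻¹' s =ᵐ[P] T ⁻¹' t :=
  hT.quasiMeasurePreserving.preimage_ae_eq h

theorem measurable_real_of_Ioi {f : Ω → ℝ} (hf : ∀ c, MeasurableSet (f ⁻¹' Set.Ioi c)) :
    Measurable f :=
  measurable_of_Ioi hf

end Completion

/-! ### The σ-algebra generated by the counts of a sub-σ-algebra. -/

section PoissonAlgebra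

variable {X : Type*} [MeasurableSpace X] {K : Set X}

theorem poissonAlgebra_le (hK : MeasurableSet K) {B : MeasurableSpace K}
    (hB : B ≤ Subtype.instMeasurableSpace) : poissonAlgebra B ≤ Config.instMeasurableSpace :=
  iSup_le fun A => (Config.measurable_count (hK.subtype_image (hB _ A.2))).comap_le

theorem measurable_count_poissonAlgebra {B : MeasurableSpace K} {A : Set K}
    (hA : MeasurableSet[B] A) :
    Measurable[poissonAlgebra B] (Config.count (Subtype.val '' A)) :=
  Measurable.of_comap_le (le_iSup (fun A : {A : Set K // MeasurableSet[B] A} =>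
    MeasurableSpace.comap (Config.count (Subtype.val '' A.1)) inferInstance) ⟨A, hA⟩)

theorem measurable_lintegral_poissonAlgebra (hK : MeasurableSet K) {B : MeasurableSpace K}
    (hB : B ≤ Subtype.instMeasurableSpace) {h : X → ℝ≥0∞} (h0 : ∀ x ∉ K, h x = 0)
    (hh : Measurable[B] fun x : K => h x) :
    Measurable[poissonAlgebra B] fun ν : Config X => ∫⁻ x, h x ∂ν.1 := by
  have key : ∀ g : K → ℝ≥0∞, Measurable[B] g → Measurable[poissonAlgebra B]
      fun ν : Config X => ∫⁻ x : K, g x ∂(restrictMeasure ν.1 K) := by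
    intro g hg
    refine @Measurable.ennreal_induction _ B (fun g => Measurable[poissonAlgebra B]
      fun ν : Config X => ∫⁻ x : K, g x ∂(restrictMeasure ν.1 K)) ?_ ?_ ?_ g hg
    · intro c A hA
      have : ∀ ν : Config X, ∫⁻ x : K, A.indicator (fun _ => c) x ∂(restrictMeasure ν.1 K) =
          c * Config.count (Subtype.val '' A) ν := by
        intro ν
        refine (lintegral_indicator_const (hB _ hA) c).trans ?_
        rw [restrictMeasure, (MeasurableEmbedding.subtype_coe hK).comap_apply]
        rfl
      simp_rw [this]
      exact (measurable_count_poissonAlgebra hA).const_mul c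
    · intro f g _ _ hg ihf ihg
      have : ∀ ν : Config X, ∫⁻ x : K, (f + g) x ∂(restrictMeasure ν.1 K) =
          ∫⁻ x : K, f x ∂(restrictMeasure ν.1 K) + ∫⁻ x : K, g x ∂(restrictMeasure ν.1 K) :=
        fun ν => lintegral_add_right (m := Subtype.instMeasurableSpace) f (hg.mono hB le_rfl)
      simp_rw [this]
      exact ihf.add ihg
    · intro f hf hmono ih
      have : ∀ ν : Config X, ∫⁻ x : K, (⨆ n, f n x) ∂(restrictMeasure ν.1 K) =
          ⨆ n, ∫⁻ x : K, f n x ∂(restrictMeasure ν.1 K) :=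
        fun ν => lintegral_iSup (m := Subtype.instMeasurableSpace)
          (fun n => (hf n).mono hB le_rfl) hmono
      simp_rw [this]
      exact Measurable.iSup ih
  have hset : ∀ ν : Config X, ∫⁻ x, h x ∂ν.1 = ∫⁻ x : K, h x ∂(restrictMeasure ν.1 K) := by
    intro ν
    refine Eq.trans ?_ (lintegral_subtype_comap hK h).symm
    refine Eq.trans (lintegral_congr fun x => ?_) (lintegral_indicator hK h)
    by_cases hx : x ∈ K
    · rw [Set.indicator_of_mem hx]
    · rw [Set.indicator_of_notMem hx, h0 x hx]
  simp_rw [hset]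
  exact key _ hh

theorem poissonAlgebra_le_nullCompletion_bot {μ : Measure X} [SigmaFinite μ]
    {P : Measure (Config X)} (hP : IsPoissonMeasure μ P) (hKm : MeasurableSet K)
    (hK : μ K = 0) (B : MeasurableSpace K) : poissonAlgebra B ≤ nullCompletion P ⊥ := by
  have := hP.isProbabilityMeasure
  have hv : P (void K) = 1 := by rw [hP.measure_void hKm, hK, expNeg_zero]
  refine iSup_le fun ⟨A, hA⟩ => Measurable.comap_le ?_
  refine Measurable.eventuallyMeasurable_of_eventuallyEq
    (@measurable_const _ _ _ ⊥ (0 : ℝ≥0∞)) ?_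
  filter_upwards [(mem_ae_iff_prob_eq_one (measurableSet_void hKm)).mpr hv] with ν hν
  exact measure_mono_null (Subtype.coe_image_subset K A) hν

end PoissonAlgebra

/-! ### The σ-algebra of locally fixed sets. -/

section FixedAlgebra

variable {X : Type*} [MeasurableSpace X] {μ : Measure X} [SigmaFinite μ] {φ : Set X → X → ℝ}

/-- The subsets of `K = ⋃ n, D n` whose trace on each of the fixed sets `D n` is fixed. -/
@[reducible]
def fixedAlgebra (hφ : IsSubMarkov μ φ) {K : Set X} (D : ℕ → Set X)
    (hD : ∀ n, IsFixedSet μ φ (D n)) (hDK : ⋃ n, D n = K) : MeasurableSpace K where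
  MeasurableSet' A := ∀ n, IsFixedSet μ φ (Subtype.val '' A ∩ D n)
  measurableSet_empty n := by simpa using isFixedSet_empty
  measurableSet_compl A hA n := by
    have h : Subtype.val '' Aᶜ ∩ D n = D n \ (Subtype.val '' A ∩ D n) := by
      have hn : D n ⊆ K := hDK ▸ Set.subset_iUnion D n
      ext x
      simp only [Set.mem_inter_iff, Set.mem_image, Set.mem_compl_iff, Subtype.exists,
        exists_and_right, exists_eq_right, Set.mem_sdiff]
      constructor
      · rintro ⟨⟨hx, hxA⟩, hxn⟩
        exact ⟨hxn, fun h => hxA h.1.2⟩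
      · rintro ⟨hxn, hx⟩
        exact ⟨⟨hn hxn, fun h => hx ⟨⟨hn hxn, h⟩, hxn⟩⟩, hxn⟩
    rw [h]
    exact (hD n).diff hφ (hA n)
  measurableSet_iUnion A hA n := by
    rw [Set.image_iUnion, Set.iUnion_inter]
    refine IsFixedSet.iUnion hφ (fun i => hA i n) ?_
    rw [← Set.iUnion_inter]
    exact (measure_mono Set.inter_subset_right).trans_lt (hD n).lt_top

variable {K : Set X} {D : ℕ → Set X}

/-- Testing on the `D n` is enough to control the trace on every fixed set, in particular on
translates of the `D n`. -/
theorem fixedAlgebra_isFixedSet_inter (hφ : IsSubMarkov μ φ) (hD : ∀ n, IsFixedSet μ φ (D n))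
    (hDK : ⋃ n, D n = K) {A : Set K} (hA : MeasurableSet[fixedAlgebra hφ D hD hDK] A)
    {C : Set X} (hC : IsFixedSet μ φ C) : IsFixedSet μ φ (Subtype.val '' A ∩ C) := by
  have h : Subtype.val '' A ∩ C = ⋃ n, (Subtype.val '' A ∩ D n) ∩ C := by
    rw [← Set.iUnion_inter, ← Set.inter_iUnion, hDK, Set.inter_assoc, ← Set.inter_assoc,
      Set.inter_eq_left.mpr (Subtype.coe_image_subset K A)]
  rw [h]
  refine IsFixedSet.iUnion hφ (fun n => (hA n).inter hφ hC) ?_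
  rw [← h]
  exact (measure_mono Set.inter_subset_right).trans_lt hC.lt_top

theorem fixedAlgebra_le (hφ : IsSubMarkov μ φ) (hD : ∀ n, IsFixedSet μ φ (D n))
    (hDK : ⋃ n, D n = K) : fixedAlgebra hφ D hD hDK ≤ Subtype.instMeasurableSpace := by
  intro A hA
  have h : Subtype.val '' A = ⋃ n, Subtype.val '' A ∩ D n := by
    rw [← Set.inter_iUnion, hDK, Set.inter_eq_left.mpr (Subtype.coe_image_subset K A)]
  have hm : MeasurableSet (Subtype.val '' A) := by
    rw [h]
    exact MeasurableSet.iUnion fun n => (hA n).1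
  rw [← Set.preimage_image_eq A Subtype.val_injective]
  exact measurable_subtype_coe hm

theorem measurableSet_fixedAlgebra_preimage (hφ : IsSubMarkov μ φ)
    (hD : ∀ n, IsFixedSet μ φ (D n)) (hDK : ⋃ n, D n = K) {C : Set X} (hC : IsFixedSet μ φ C) :
    MeasurableSet[fixedAlgebra hφ D hD hDK] (Subtype.val ⁻¹' C : Set K) := by
  intro n
  have hn : D n ⊆ K := hDK ▸ Set.subset_iUnion D n
  rw [Subtype.image_preimage_coe, Set.inter_comm K, Set.inter_assoc, Set.inter_eq_right.mpr hn]
  exact hC.inter hφ (hD n)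

theorem measurable_fixedAlgebra (hφ : IsSubMarkov μ φ) (hD : ∀ n, IsFixedSet μ φ (D n))
    (hDK : ⋃ n, D n = K) {f : X → ℝ} (hf : IsFixed μ φ f) (hf0 : ∀ x, 0 ≤ f x) :
    Measurable[fixedAlgebra hφ D hD hDK] fun x : K => f x := by
  have hpos : ∀ c : ℝ, 0 < c →
      MeasurableSet[fixedAlgebra hφ D hD hDK] {x : K | c < f x} := fun c hc =>
    measurableSet_fixedAlgebra_preimage hφ hD hDK (hf.isFixedSet_lt hφ hf0 hc)
  refine measurable_real_of_Ioi fun c => ?_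
  rcases lt_trichotomy c 0 with hc | rfl | hc
  · convert @MeasurableSet.univ _ (fixedAlgebra hφ D hD hDK)
    exact Set.eq_univ_of_forall fun x => hc.trans_le (hf0 x)
  -- Level `0` is special: `0 < f` may have infinite measure and so need not be a fixed set, but it
  -- is a countable union of positive superlevel sets.
  · convert @MeasurableSet.iUnion _ _ (fixedAlgebra hφ D hD hDK) _ _
      fun k : ℕ => hpos (1 / (k + 1)) (by positivity)
    ext x
    simp only [Set.mem_preimage, Set.mem_Ioi, Set.mem_iUnion, Set.mem_ofPred_eq]
    exact ⟨fun h => exists_nat_one_div_lt h, fun ⟨k, hk⟩ => lt_trans (by positivity) hk⟩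
  · exact hpos c hc

theorem sigmaFinite_fixedAlgebra (hφ : IsSubMarkov μ φ) (hD : ∀ n, IsFixedSet μ φ (D n))
    (hDK : ⋃ n, D n = K) :
    SigmaFinite ((restrictMeasure μ K).trim (fixedAlgebra_le hφ hD hDK)) := by
  have hK : MeasurableSet K := hDK ▸ MeasurableSet.iUnion fun n => (hD n).1
  refine ⟨⟨⟨fun n => Subtype.val ⁻¹' D n, fun _ => trivial, fun n => ?_, ?_⟩⟩⟩
  · rw [trim_measurableSet_eq _ (measurableSet_fixedAlgebra_preimage hφ hD hDK (hD n)),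
      restrictMeasure, (MeasurableEmbedding.subtype_coe hK).comap_apply]
    exact (measure_mono (Set.image_preimage_subset _ _)).trans_lt (hD n).lt_top
  · rw [← Set.preimage_iUnion, hDK]
    simp

end FixedAlgebra

/-! ### The invariant set carrying the fixed sets. -/

section Exhaustion

variable {X : Type*} [MeasurableSpace X] [StandardBorelSpace X] {μ : Measure X} [SigmaFinite μ]
  [NullSingletonClass μ] {P : Measure (Config X)} {φ : Set X → X → ℝ}
  {F : MeasurableSpace (Config X)}

/-- Countably many fixed sets cover all fixed sets up to null sets. -/
theorem IsVoidKernel.exists_exhaustion (hP : IsPoissonMeasure μ P)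
    (hF : F ≤ Config.instMeasurableSpace) (hφ : IsVoidKernel μ P F φ) :
    ∃ C : ℕ → Set X, (∀ n, IsFixedSet μ φ (C n)) ∧
      ∀ A, IsFixedSet μ φ A → μ (A \ ⋃ n, C n) = 0 := by
  have hs := hφ.subMarkov
  have hS := measurableSet_spanningSets μ
  have hμS := measure_spanningSets_lt_top μ
  let C : ℕ × ℕ → Set X := fun p => {x | 1 / ((p.2 : ℝ) + 1) < φ (spanningSets μ p.1) x}
  have hC : ∀ p, IsFixedSet μ φ (C p) := fun p =>
    (hφ.isFixed hP hF (hS p.1) (hμS p.1)).isFixedSet_lt hs (hs.nonneg _ (hS p.1) (hμS p.1))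
      (by positivity)
  refine ⟨fun n => C (Nat.pairEquiv.symm n), fun n => hC _, fun A hA => ?_⟩
  have hU : ⋃ n, C (Nat.pairEquiv.symm n) = ⋃ p, C p :=
    Nat.pairEquiv.symm.surjective.iUnion_comp C
  have hE : IsFixedSet μ φ (A \ ⋃ n, C (Nat.pairEquiv.symm n)) := by
    have h1 : IsFixedSet μ φ (⋃ n, A ∩ C (Nat.pairEquiv.symm n)) := by
      refine IsFixedSet.iUnion hs (fun n => hA.inter hs (hC _)) ?_
      rw [← Set.inter_iUnion]
      exact (measure_mono Set.inter_subset_left).trans_lt hA.lt_top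
    have h2 := hA.diff hs h1
    rwa [← Set.inter_iUnion, Set.sdiff_self_inter] at h2
  set E := A \ ⋃ n, C (Nat.pairEquiv.symm n) with hEdef
  -- The remainder `E` is fixed and misses every superlevel set of the `φ (spanningSets μ n)`. By
  -- symmetry `μ (E ∩ spanningSets μ n)` is the integral of `φ (spanningSets μ n)` over `E`, hence
  -- `0`.
  have hzero : ∀ n, ∀ x ∈ E, φ (spanningSets μ n) x = 0 := by
    intro n x hx
    refine le_antisymm ?_ (hs.nonneg _ (hS n) (hμS n) x)
    by_contra! h
    obtain ⟨k, hk⟩ := exists_nat_one_div_lt h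
    exact hx.2 (hU ▸ Set.mem_iUnion.mpr ⟨(n, k), hk⟩)
  have hnull : ∀ n, μ (E ∩ spanningSets μ n) = 0 := by
    intro n
    have h1 := (hφ.isFixedSet_iff hE.1 hE.lt_top).mp hE _ (hS n) (hμS n)
    rw [hφ.symm _ _ hE.1 (hS n) hE.lt_top (hμS n), setIntegral_congr_fun hE.1 (hzero n)] at h1
    simp only [integral_zero] at h1
    have h2 : μ (E ∩ spanningSets μ n) ≠ ∞ :=
      ((measure_mono Set.inter_subset_left).trans_lt hE.lt_top).ne
    exact (measureReal_eq_zero_iff h2).mp h1.symm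
  rw [← Set.inter_univ E, ← iUnion_spanningSets μ, Set.inter_iUnion]
  exact measure_iUnion_null hnull

variable {G : Type*} [Group G] [MulAction G X] [MeasurableConstSMul G X]
  [SMulInvariantMeasure G X μ]

theorem IsVoidKernel.isFixedSet_preimage_smul (hP : IsPoissonMeasure μ P) (hF : IsFactor G P F)
    (hφ : IsVoidKernel μ P F φ) (g : G) {A : Set X} (hA : IsFixedSet μ φ A) :
    IsFixedSet μ φ ((g • ·) ⁻¹' A) := by
  have hAm : MeasurableSet ((g • ·) ⁻¹' A) := measurable_const_smul g hA.1
  have hμA : μ ((g • ·) ⁻¹' A) < ∞ := by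
    rw [SMulInvariantMeasure.measure_preimage_smul g hA.1]
    exact hA.lt_top
  rw [hφ.isFixedSet_iff_void hP hF.le hAm hμA, ← smul_preimage_void g hA.1]
  obtain ⟨t, ht, hvt⟩ := (hφ.isFixedSet_iff_void hP hF.le hA.1 hA.lt_top).mp hA
  exact ⟨_, hF.invariant g t ht,
    preimage_ae_eq_of_measurePreserving (hP.measurePreserving_smul g) hvt⟩

/-- A `G`-invariant set, a countable union of fixed sets, that contains all fixed sets up to null
sets. -/
theorem IsVoidKernel.exists_subMulAction [Countable G] (hP : IsPoissonMeasure μ P)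
    (hF : IsFactor G P F) (hφ : IsVoidKernel μ P F φ) :
    ∃ (K : SubMulAction G X) (D : ℕ → Set X), (∀ n, IsFixedSet μ φ (D n)) ∧
      ⋃ n, D n = (K : Set X) ∧ ∀ A, IsFixedSet μ φ A → μ (A \ (K : Set X)) = 0 := by
  obtain ⟨C, hC, hCA⟩ := hφ.exists_exhaustion hP hF.le
  -- All translates of the exhausting sets are added to make `K` invariant; `G` being countable, the
  -- union stays countable.
  let T : G × ℕ → Set X := fun p => (p.1 • ·) ⁻¹' C p.2
  have hT : ∀ p, IsFixedSet μ φ (T p) := fun p => hφ.isFixedSet_preimage_smul hP hF p.1 (hC p.2)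
  let K : SubMulAction G X :=
    { carrier := ⋃ p, T p
      smul_mem' := by
        intro h x hx
        obtain ⟨⟨g, n⟩, hgn⟩ := Set.mem_iUnion.mp hx
        refine Set.mem_iUnion.mpr ⟨(g * h⁻¹, n), ?_⟩
        change (g * h⁻¹) • h • x ∈ C n
        rw [smul_smul, inv_mul_cancel_right]
        exact hgn }
  obtain ⟨e, he⟩ := exists_surjective_nat (G × ℕ)
  refine ⟨K, fun n => T (e n), fun n => hT _, he.iUnion_comp T, fun A hA => ?_⟩
  refine measure_mono_null (Set.sdiff_subset_sdiff_right ?_) (hCA A hA)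
  refine Set.iUnion_subset fun n x hx => Set.mem_iUnion.mpr ⟨(1, n), ?_⟩
  change (1 : G) • x ∈ C n
  rwa [one_smul]

/-- Invariance comes from `g⁻¹ A ∩ D n = g⁻¹ (A ∩ g (D n))`, where `g (D n)` is again a fixed set.
-/
theorem IsVoidKernel.isFactor_fixedAlgebra (hP : IsPoissonMeasure μ P) (hF : IsFactor G P F)
    (hφ : IsVoidKernel μ P F φ) (K : SubMulAction G X) {D : ℕ → Set X}
    (hD : ∀ n, IsFixedSet μ φ (D n)) (hDK : ⋃ n, D n = (K : Set X)) :
    IsFactor G (restrictMeasure μ (K : Set X)) (fixedAlgebra hφ.subMarkov D hD hDK) := by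
  refine ⟨fixedAlgebra_le hφ.subMarkov hD hDK, fun g A hA n => ?_,
    sigmaFinite_fixedAlgebra hφ.subMarkov hD hDK⟩
  have h1 := fixedAlgebra_isFixedSet_inter hφ.subMarkov hD hDK hA
    (hφ.isFixedSet_preimage_smul hP hF g⁻¹ (hD n))
  have h2 := hφ.isFixedSet_preimage_smul hP hF g h1
  convert h2 using 1
  ext x
  constructor
  · rintro ⟨⟨y, hy, rfl⟩, hyn⟩
    refine ⟨⟨g • y, hy, rfl⟩, ?_⟩
    change g⁻¹ • g • (y : X) ∈ D n
    rwa [inv_smul_smul]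
  · rintro ⟨⟨y, hy, hyx⟩, hyn⟩
    have hyn' : g⁻¹ • g • x ∈ D n := hyn
    rw [inv_smul_smul] at hyn'
    have hxK : x ∈ (K : Set X) := hDK ▸ Set.mem_iUnion.mpr ⟨n, hyn'⟩
    refine ⟨⟨⟨x, hxK⟩, ?_, rfl⟩, hyn'⟩
    have : g • (⟨x, hxK⟩ : (K : Set X)) = y := Subtype.ext hyx.symm
    change g • (⟨x, hxK⟩ : (K : Set X)) ∈ A
    rwa [this]

end Exhaustion

/-! ### The two inclusions and the conclusion. -/

section Main

variable {X : Type*} [MeasurableSpace X] [StandardBorelSpace X] {μ : Measure X} [SigmaFinite μ]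
  [NullSingletonClass μ] {P : Measure (Config X)} {φ : Set X → X → ℝ}
  {F : MeasurableSpace (Config X)} {K : Set X} {D : ℕ → Set X}

theorem IsVoidKernel.poissonAlgebra_le_nullCompletion (hP : IsPoissonMeasure μ P)
    (hF : F ≤ Config.instMeasurableSpace) (hφ : IsVoidKernel μ P F φ)
    (hD : ∀ n, IsFixedSet μ φ (D n)) (hDK : ⋃ n, D n = K) :
    poissonAlgebra (fixedAlgebra hφ.subMarkov D hD hDK) ≤ nullCompletion P F := by
  refine iSup_le fun ⟨A, hA⟩ => Measurable.comap_le ?_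
  have hfix : ∀ n, IsFixedSet μ φ (disjointed D n) := fun n =>
    disjointedRec (fun _ i ht => ht.diff hφ.subMarkov (hD i)) (hD n)
  have hAn : ∀ n, IsFixedSet μ φ (Subtype.val '' A ∩ disjointed D n) := fun n =>
    fixedAlgebra_isFixedSet_inter hφ.subMarkov hD hDK hA (hfix n)
  have hcount : Config.count (Subtype.val '' A) =
      fun ν => ∑' n, Config.count (Subtype.val '' A ∩ disjointed D n) ν := by
    funext ν
    have h : Subtype.val '' A = ⋃ n, Subtype.val '' A ∩ disjointed D n := by
      rw [← Set.inter_iUnion, iUnion_disjointed, hDK,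
        Set.inter_eq_left.mpr (Subtype.coe_image_subset K A)]
    calc Config.count (Subtype.val '' A) ν = ν.1 (⋃ n, Subtype.val '' A ∩ disjointed D n) := by
          rw [← h]
          rfl
      _ = ∑' n, Config.count (Subtype.val '' A ∩ disjointed D n) ν :=
          measure_iUnion (fun a b hab => ((disjoint_disjointed _ hab).mono
            Set.inter_subset_right Set.inter_subset_right)) fun n => (hAn n).1
  rw [hcount]
  exact measurable_tsum_ennreal fun n => hφ.measurable_count hP hF (hAn n)

/-- The positive superlevel sets of `φ A` are fixed, hence inside `K` mod `μ`. So `φ A` may be cut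
off outside `K`, where it becomes an integrand measurable for the fixed algebra. -/
theorem IsVoidKernel.exists_condExp_void (hP : IsPoissonMeasure μ P)
    (hF : F ≤ Config.instMeasurableSpace) (hφ : IsVoidKernel μ P F φ)
    (hD : ∀ n, IsFixedSet μ φ (D n)) (hDK : ⋃ n, D n = K)
    (hK : ∀ A, IsFixedSet μ φ A → μ (A \ K) = 0) {A : Set X} (hA : MeasurableSet A)
    (hμA : μ A < ∞) :
    ∃ Y : Config X → ℝ, Measurable[poissonAlgebra (fixedAlgebra hφ.subMarkov D hD hDK)] Y ∧
      P[(void A).indicator fun _ => (1 : ℝ)|F] =ᵐ[P] Y := by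
  have hs := hφ.subMarkov
  have hKm : MeasurableSet K := hDK ▸ MeasurableSet.iUnion fun n => (hD n).1
  have hfix := hφ.isFixed hP hF hA hμA
  have hφ0 := hs.nonneg A hA hμA
  have hae : K.indicator (φ A) =ᵐ[μ] φ A := by
    have hnull : μ (⋃ k : ℕ, {x | 1 / ((k : ℝ) + 1) < φ A x} \ K) = 0 :=
      measure_iUnion_null fun k => hK _ (hfix.isFixedSet_lt hs hφ0 (by positivity))
    filter_upwards [measure_eq_zero_iff_ae_notMem.mp hnull] with x hx
    by_cases hxK : x ∈ K
    · rw [Set.indicator_of_mem hxK]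
    · rw [Set.indicator_of_notMem hxK]
      by_contra hne
      obtain ⟨k, hk⟩ := exists_nat_one_div_lt ((hφ0 x).lt_of_ne hne)
      exact hx (Set.mem_iUnion.mpr ⟨k, hk, hxK⟩)
  refine ⟨_, ?_, hφ.condExp_void hP hA hμA ((hs.measurable A hA hμA).indicator hKm)
    (fun x => Set.indicator_nonneg (fun x _ => hφ0 x) x)
    (fun x => Set.indicator_le' (fun x _ => hs.le_one A hA hμA x) (fun _ _ => zero_le_one) x) hae⟩
  refine Measurable.const_mul (Measurable.ennreal_toReal (measurable_expNeg.comp ?_)) _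
  refine measurable_lintegral_poissonAlgebra hKm (fixedAlgebra_le hs hD hDK)
    (fun x hx => by simp [hx, negLog]) ?_
  refine measurable_negLog.comp (ENNReal.measurable_ofReal.comp ?_)
  refine Measurable.const_sub ?_ 1
  have : (fun x : K => K.indicator (φ A) x) = fun x : K => φ A x :=
    funext fun x => Set.indicator_of_mem x.2 _
  rw [this]
  exact measurable_fixedAlgebra hs hD hDK hfix hφ0

/-- If the conditional expectations of the void events given `F` are measurable with respect to a
sub-`σ`-algebra `E` of the completion of `F`, then `F` is contained in the completion of `E`. -/
theorem le_nullCompletion_of_condExp_void (hP : IsPoissonMeasure μ P)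
    {E : MeasurableSpace (Config X)} (hF : F ≤ Config.instMeasurableSpace)
    (hE : E ≤ Config.instMeasurableSpace) (hEF : E ≤ nullCompletion P F)
    (h : ∀ A, MeasurableSet A → μ A < ∞ → ∃ Y : Config X → ℝ, Measurable[E] Y ∧
      P[(void A).indicator fun _ => (1 : ℝ)|F] =ᵐ[P] Y) : F ≤ nullCompletion P E := by
  have := hP.isProbabilityMeasure
  intro s hs
  have hsi : Integrable (s.indicator fun _ => (1 : ℝ)) P :=
    (integrable_const (1 : ℝ)).indicator (hF s hs)
  refine measurableSet_nullCompletion_of_ae_eq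
    (stronglyMeasurable_condExp (m := E) (μ := P) (f := s.indicator fun _ => (1 : ℝ))).measurable
    (hP.ae_eq_of_setIntegral_void hsi integrable_condExp fun A hA hμA => ?_)
  have hv := measurableSet_void hA
  have hvi : Integrable ((void A).indicator fun _ => (1 : ℝ)) P :=
    (integrable_const (1 : ℝ)).indicator hv
  obtain ⟨Y, hY, hYF⟩ := h A hA hμA
  -- As `E` lies in the completion of `F`, an `E`-measurable version of the conditional expectation
  -- given `F` is also the one given `E`.
  have hYE : Y =ᵐ[P] P[(void A).indicator fun _ => (1 : ℝ)|E] := by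
    refine ae_eq_condExp_of_forall_setIntegral_eq hE hvi
      (fun _ _ _ => (integrable_condExp.congr hYF).integrableOn) (fun t ht _ => ?_)
      hY.stronglyMeasurable.aestronglyMeasurable
    obtain ⟨t', ht', htt'⟩ := hEF t ht
    rw [setIntegral_congr_set htt', setIntegral_congr_set htt',
      ← integral_congr_ae (ae_restrict_of_ae hYF), setIntegral_condExp hF hvi ht']
  -- Self-adjointness moves the conditioning from `1_s` to `1_{void A}`, where `E` and `F` agree. So
  -- `1_s` and `E[1_s | E]` have equal integrals over void events, and `s` is in `E` mod `P`.
  have hEs := integral_condExp_mul_comm hE hsi.aestronglyMeasurable hvi.aestronglyMeasurable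
    (norm_indicator_one_le s) (norm_indicator_one_le (void A))
  have hFs := integral_condExp_mul_comm hF hsi.aestronglyMeasurable hvi.aestronglyMeasurable
    (norm_indicator_one_le s) (norm_indicator_one_le (void A))
  have hsF : P[s.indicator fun _ => (1 : ℝ)|F] = s.indicator fun _ => (1 : ℝ) :=
    condExp_of_stronglyMeasurable hF (stronglyMeasurable_const.indicator hs) hsi
  rw [hsF] at hFs
  simp_rw [mul_indicator_one] at hEs hFs
  rw [integral_indicator hv] at hEs hFs
  rw [hEs, hFs]
  refine integral_congr_ae ?_
  filter_upwards [hYF, hYE] with ν h1 h2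
  rw [h1, h2]

end Main

end PoissonSuspension

open PoissonSuspension in
theorem mainTheorem11 {X G : Type*} [MeasurableSpace X] [StandardBorelSpace X]
    [Group G] [Countable G] [MulAction G X] [MeasurableConstSMul G X]
    (μ : Measure X) [SigmaFinite μ] [NullSingletonClass μ] (hμ : μ Set.univ = ∞)
    [SMulInvariantMeasure G X μ]
    (P : Measure (Config X)) (hP : IsPoissonMeasure μ P)
    (J : Measure (Config X × Config X))
    (F : MeasurableSpace (Config X)) (hF : IsFactor G P F)
    (hF_nontrivial : ∃ s, MeasurableSet[F] s ∧ P s ≠ 0 ∧ P s ≠ 1)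
    (hJ : IsRelIndepSelfJoining F P J) (hJ_div : IsInfinitelyDivisible J) :
    ∃ K : SubMulAction G X, MeasurableSet (K : Set X) ∧ 0 < μ (K : Set X) ∧
      ∃ B : MeasurableSpace (K : Set X), IsFactor G (restrictMeasure μ (K : Set X)) B ∧
        nullCompletion P F = nullCompletion P (poissonAlgebra B) := by
  have := hP.isProbabilityMeasure
  obtain ⟨φ, hφ⟩ := exists_isVoidKernel hP hJ_div hF.le hJ
  obtain ⟨K, D, hD, hDK, hK⟩ := hφ.exists_subMulAction hP hF
  have hKm : MeasurableSet (K : Set X) := hDK ▸ MeasurableSet.iUnion fun n => (hD n).1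
  have hle := hφ.poissonAlgebra_le_nullCompletion hP hF.le hD hDK
  have hge := le_nullCompletion_of_condExp_void hP hF.le
    (poissonAlgebra_le hKm (fixedAlgebra_le hφ.subMarkov hD hDK)) hle
    fun A hA hμA => hφ.exists_condExp_void hP hF.le hD hDK hK hA hμA
  refine ⟨K, hKm, pos_iff_ne_zero.mpr fun hK0 => ?_, _, hφ.isFactor_fixedAlgebra hP hF K hD hDK,
    le_antisymm (nullCompletion_le hge) (nullCompletion_le hle)⟩
  -- If `K` were null, almost surely no point would fall in it; every count on `K` would vanish and
  -- `F` would be trivial mod `P`.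
  obtain ⟨s, hs, hs0, hs1⟩ := hF_nontrivial
  obtain ⟨t, ht, hst⟩ := nullCompletion_le
    (poissonAlgebra_le_nullCompletion_bot hP hKm hK0 _) s (hge s hs)
  rcases MeasurableSpace.measurableSet_bot_iff.mp ht with rfl | rfl
  · exact hs0 (by rw [measure_congr hst, measure_empty])
  · exact hs1 (by rw [measure_congr hst, measure_univ])
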